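/- Theorem B. Let $X$ be a regular CW complex and let $f$ be a discrete Morse function on $X$: a function from the cells of $X$ to $\mathbb{R}$ such that for each $k$-cell $x$ there is at most one $(k+1)$-cell $y\supseteq x$ with $f(x)\ge f(y)$ and at most one $(k-1)$-cell $y\subseteq x$ with $f(y)\ge f(x)$. A cell is critical if there are no such cells $y$ at all; a regular pair is a pair $\{x,y\}$ with $x\subseteq y$, $\dim y=\dim x+1$ and $f(x)\ge f(y)$. Let $\mathrm{Ent}[X]$ be the entrance path category: objects are the cells, morphisms $x\to y$ are strictly descending sequences $(x=x_0>x_1>\dots>x_k=y)$ of cells, composition is concatenation, and $g\Rightarrow g'$ if $g$ is a subsequence of $g'$. Let $\Sigma$ be the set of the morphisms $(y>x)$ with $\{x,y\}$ a regular pair, and $\Sigma^+$ its union with all identities. Let $\mathrm{Loc}_\Sigma[X]$ be the localization: its objects are the cells, its morphisms $w\to z$ are the zigzags $w\xrightarrow{g_0}y_0\xleftarrow{f_0}x_0\xrightarrow{g_1}\cdots\xleftarrow{f_k}x_k\xrightarrow{g_{k+1}}z$ with all $f_i\in\Sigma^+$, modulo the equivalence relation generated by dropping intermediate identities and by commutative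 ladders between two zigzags with vertical maps in $\Sigma^+$ and identities at both ends. Composition is concatenation. The order is the transitive closure of the following relation: $\gamma'\Rightarrow\gamma$ if representatives of $\gamma$ and of $\gamma'$ are the top and the bottom row of such a ladder, in which, instead of commutativity, in each square the composite through the lower row is $\Rightarrow$ the composite through the upper row. The discrete flow category $\mathrm{Flo}_\Sigma[X]$ is the full subcategory of $\mathrm{Loc}_\Sigma[X]$ on the critical cells; it is a category enriched in posets. Let $S$ be the double nerve of $\mathrm{Flo}_\Sigma[X]$: the bisimplicial set whose $(p,q)$-simplices are the $q$-simplices of the nerve of the category with the same objects, whose morphisms $a\to b$ are the chains $f_0\Rightarrow\dots\Rightarrow f_p$ in $\mathrm{Hom}(a,b)$, composed entrywise. Let $K$ be the double complex $K_{p,q}=\mathbb{Z}S_{p,q}$ with the alternating sums of the horizontal and vertical face maps as differentials $\partial_h\colon K_{p,q}\to K_{p-1,q}$ and $\partial_v\colon K_{p,q}\to K_{p,q-1}$, with total differential $\partial_v+(-1)^q\partial_h$, and let $\{E^r_{p,q},\ d^r\colon E^r_{p,q}\to E^r_{p-r,q+r-1}\}$ be its first spectral sequence (vertical homology first), i.e.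 the spectral sequence of the filtration of the total complex by columns. Then this spectral sequence collapses at page $2$: $d^r_{p,q}=0$ for all $r\ge 2$ and all $p,q$. Moreover, $E^1_{p,q}=0$ for all $p$ and all $q\ge 2$, and $E^2_{p,0}=0$ for all $p\ge 1$. -/

import Mathlib

universe v u

open CategoryTheory

/-! ### Poset-enriched categories and their double nerve -/

/-- A p-category: a category whose hom-sets are posets, with monotone composition.
`f ≤ f'` is the relation written `f ⇒ f'`. -/
class PCategory (A : Type u) extends Category.{v} A where
  homPartialOrder (a b : A) : PartialOrder (a ⟶ b)
  comp_le_comp {a b c : A} {f f' : a ⟶ b} {g g' : b ⟶ c} :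
    f ≤ f' → g ≤ g' → f ≫ g ≤ f' ≫ g'

attribute [instance] PCategory.homPartialOrder

/-- The objects of the level-`n` category of the simplicial category of `A`: those of `A`. -/
@[ext]
structure NLevel (A : Type u) (n : ℕ) where
  obj : A

/-- Level `n`: a morphism `a ⟶ b` is a chain `f 0 ⇒ f 1 ⇒ ⋯ ⇒ f n` of morphisms `a ⟶ b`,
and chains are composed entrywise. -/
instance NLevel.category (A : Type u) [PCategory.{v} A] (n : ℕ) : Category.{v} (NLevel A n) where
  Hom a b := Fin (n + 1) →o (a.obj ⟶ b.obj)
  id a := ⟨fun _ => 𝟙 a.obj, fun _ _ _ => le_rfl⟩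
  comp f g := ⟨fun i => f i ≫ g i,
    fun _ _ h => PCategory.comp_le_comp (f.monotone h) (g.monotone h)⟩
  id_comp f := by apply OrderHom.ext; funext i; exact Category.id_comp (f i)
  comp_id f := by apply OrderHom.ext; funext i; exact Category.comp_id (f i)
  assoc f g h := by
    apply OrderHom.ext; funext i; exact Category.assoc (f i) (g i) (h i)

/-- Reindexing chains along a monotone map. -/
def NLevel.map (A : Type u) [PCategory.{v} A] {m n : ℕ} (θ : Fin (m + 1) →o Fin (n + 1)) :
    NLevel A n ⥤ NLevel A m where
  obj a := ⟨a.obj⟩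
  map {a b} f := OrderHom.comp (show Fin (n + 1) →o (a.obj ⟶ b.obj) from f) θ
  map_id _ := rfl
  map_comp _ _ := rfl

/-- The simplicial category of a p-category. -/
def simplicialCat (A : Type u) [PCategory.{v} A] : SimplexCategoryᵒᵖ ⥤ Cat.{v, u} where
  obj n := Cat.of (NLevel A n.unop.len)
  map θ := (NLevel.map A θ.unop.toOrderHom).toCatHom
  map_id _ := rfl
  map_comp _ _ := rfl

/-- The double nerve of a p-category, a bisimplicial set: `(p, q)`-simplices are `q`-simplices
of the nerve of the level-`p` category, i.e. `q` horizontally composable chains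
`f 0 ⇒ ⋯ ⇒ f p`. -/
def doubleNerve (A : Type u) [PCategory.{v} A] : SimplexCategoryᵒᵖ ⥤ SSet.{max u v} :=
  simplicialCat A ⋙ nerveFunctor

/-! ### The double complex of a bisimplicial set and its first spectral sequence -/

/-- The double complex `ℤ S_{p,q}` of a bisimplicial set `S`, with differentials the alternating
sums of the face maps. The outer (horizontal) index is `p`, the inner (vertical) index is `q`. -/
noncomputable def bisimplicialDoubleComplex (S : SimplexCategoryᵒᵖ ⥤ SSet.{u}) :
    HomologicalComplex₂ AddCommGrpCat.{u} (ComplexShape.down ℕ) (ComplexShape.down ℕ) :=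
  (AlgebraicTopology.alternatingFaceMapComplex (ChainComplex AddCommGrpCat.{u} ℕ)).obj
    (S ⋙ (SimplicialObject.whiskering (Type u) AddCommGrpCat.{u}).obj AddCommGrpCat.free ⋙
      AlgebraicTopology.alternatingFaceMapComplex AddCommGrpCat.{u})

namespace DoubleCx

variable (K : HomologicalComplex₂ AddCommGrpCat.{u} (ComplexShape.down ℕ) (ComplexShape.down ℕ))

/-- The entry `K_{p,q}`. -/
abbrev entry (pq : ℕ × ℕ) : Type u := (K.X pq.1).X pq.2

/-- The vertical differential `K_{p,q} → K_{p,q-1}` (zero for `q = 0`). -/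
noncomputable def dv (p q : ℕ) : entry K (p, q) →+ entry K (p, q - 1) :=
  ((K.X p).d q (q - 1)).hom

/-- The horizontal differential `K_{p,q} → K_{p-1,q}` (zero for `p = 0`). -/
noncomputable def dh (p q : ℕ) : entry K (p, q) →+ entry K (p - 1, q) :=
  ((K.d p (p - 1)).f q).hom

/-- The total complex, as the direct sum of all entries; `K_{p,q}` has degree `p + q`. -/
abbrev Tot : Type u := DirectSum (ℕ × ℕ) (entry K)

/-- The inclusion of `K_{p,q}` into the total complex. -/
noncomputable abbrev ι (p q : ℕ) : entry K (p, q) →+ Tot K := DirectSum.of (entry K) (p, q)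

/-- The total differential `∂_v + (-1)^q ∂_h`. -/
noncomputable def D : Tot K →+ Tot K :=
  DirectSum.toAddMonoid fun pq =>
    (ι K pq.1 (pq.2 - 1)).comp (dv K pq.1 pq.2) +
    ((-1 : ℤ) ^ pq.2) • (ι K (pq.1 - 1) pq.2).comp (dh K pq.1 pq.2)

/-- The filtration by columns: `F p n` is the part of degree `n` of the total complex that is
supported in the columns `≤ p`. -/
def F (p n : ℤ) : AddSubgroup (Tot K) where
  carrier := {x | ∀ ij : ℕ × ℕ, x ij ≠ 0 → (ij.1 : ℤ) ≤ p ∧ (ij.1 : ℤ) + ij.2 = n}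
  zero_mem' := fun ij h => absurd rfl h
  add_mem' := by
    intro x y hx hy ij h
    by_cases h0 : x ij = 0
    · exact hy ij fun h1 => h (by rw [DirectSum.add_apply, h0, h1, add_zero])
    · exact hx ij h0
  neg_mem' := by
    intro x hx ij h
    exact hx ij fun h1 => h (by rw [DFinsupp.neg_apply, h1, neg_zero])

/-- `Z r p q`: the elements of `F p` of degree `p + q` whose differential lies in `F (p - r)`. -/
noncomputable def Z (r p q : ℤ) : AddSubgroup (Tot K) :=
  F K p (p + q) ⊓ (F K (p - r) (p + q - 1)).comap (D K)

/-- `B r p q = Z^{r-1}_{p-1,q+1} + D Z^{r-1}_{p+r-1,q-r+2}`. -/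
noncomputable def B (r p q : ℤ) : AddSubgroup (Tot K) :=
  Z K (r - 1) (p - 1) (q + 1) ⊔ (Z K (r - 1) (p + r - 1) (q - r + 2)).map (D K)

/-- The entry `E^r_{p,q} = Z^r_{p,q} / (Z^{r-1}_{p-1,q+1} + D Z^{r-1}_{p+r-1,q-r+2})` of the
first spectral sequence of the double complex `K` (the spectral sequence of the filtration of the
total complex by columns, so that `E^0` is `K` with its vertical differential). -/
abbrev E (r p q : ℤ) : Type u := Z K r p q ⧸ (B K r p q).addSubgroupOf (Z K r p q)

lemma D_ι (p q : ℕ) (x : entry K (p, q)) :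
    D K (ι K p q x) = ι K p (q - 1) (dv K p q x) + ((-1 : ℤ) ^ q) • ι K (p - 1) q (dh K p q x) := by
  simp [D]

lemma dv_dv (p q : ℕ) (x : entry K (p, q)) : dv K p (q - 1) (dv K p q x) = 0 := by
  have h := (K.X p).d_comp_d q (q - 1) (q - 1 - 1)
  exact congrArg (fun f => f.hom x) h

lemma dh_dh (p q : ℕ) (x : entry K (p, q)) : dh K (p - 1) q (dh K p q x) = 0 := by
  have h := congrArg (fun f => f.f q) (K.d_comp_d p (p - 1) (p - 1 - 1))
  exact congrArg (fun f => f.hom x) h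

lemma dv_dh (p q : ℕ) (x : entry K (p, q)) :
    dv K (p - 1) q (dh K p q x) = dh K p (q - 1) (dv K p q x) := by
  have h := (K.d p (p - 1)).comm q (q - 1)
  exact congrArg (fun f => f.hom x) h

lemma dv_zero (p : ℕ) (x : entry K (p, 0)) : dv K p 0 x = 0 := by
  have h : (K.X p).d 0 (0 - 1) = 0 := (K.X p).shape _ _ (by simp)
  exact congrArg (fun f => f.hom x) h

lemma D_D (x : Tot K) : D K (D K x) = 0 := by
  induction x using DirectSum.induction_on with
  | zero => simp
  | add x y hx hy => simp [hx, hy]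
  | of pq x =>
    obtain ⟨p, q⟩ := pq
    change D K (D K (ι K p q x)) = 0
    rw [D_ι, map_add, map_zsmul, D_ι, D_ι, dv_dv, dh_dh, dv_dh]
    rcases q with _ | q
    · rw [dv_zero]
      simp
    · simp [pow_succ]

/-- `Z^r_{p,q}` is mapped to `Z^r_{p-r,q+r-1}` by the total differential. -/
lemma D_mem_Z {r p q : ℤ} {x : Tot K} (hx : x ∈ Z K r p q) :
    D K x ∈ Z K r (p - r) (q + r - 1) := by
  refine ⟨?_, ?_⟩
  · have h : (p - r) + (q + r - 1) = p + q - 1 := by ring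
    rw [h]
    exact hx.2
  · change D K (D K x) ∈ F K (p - r - r) (p - r + (q + r - 1) - 1)
    rw [D_D]
    exact AddSubgroup.zero_mem _

lemma D_mem_B {r p q : ℤ} {x : Tot K} (hx : x ∈ B K r p q) :
    D K x ∈ B K r (p - r) (q + r - 1) := by
  obtain ⟨y, hy, z, hz, rfl⟩ := AddSubgroup.mem_sup.1 hx
  obtain ⟨w, -, rfl⟩ := hz
  rw [map_add, D_D, add_zero]
  refine AddSubgroup.mem_sup_right ⟨y, ?_, rfl⟩
  have h1 : p - r + r - 1 = p - 1 := by ring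
  have h2 : q + r - 1 - r + 2 = q + 1 := by ring
  rw [h1, h2]
  exact hy

/-- The differential `d^r : E^r_{p,q} → E^r_{p-r,q+r-1}`, induced by the total differential. -/
noncomputable def d (r p q : ℤ) : E K r p q →+ E K r (p - r) (q + r - 1) :=
  QuotientAddGroup.map _ _
    (((D K).comp (Z K r p q).subtype).codRestrict (Z K r (p - r) (q + r - 1))
      fun x => D_mem_Z K x.2)
    (fun _ hx => D_mem_B K hx)

end DoubleCx

/-! ### Localization of a p-category at a class of morphisms -/

/-- `W` together with all identities. -/
inductive PlusId {A : Type u} [Category.{v} A] (W : MorphismProperty A) :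
    ∀ ⦃a b : A⦄, (a ⟶ b) → Prop
  | id (a : A) : PlusId W (𝟙 a)
  | of {a b : A} (f : a ⟶ b) (hf : W f) : PlusId W f

/-- WZigzags `w ⟶ y₀ ⟵ x₀ ⟶ y₁ ⟵ ⋯ ⟵ x_k ⟶ z`, whose backward arrows are in `W` or
identities. -/
inductive WZigzag {A : Type u} [Category.{v} A] (W : MorphismProperty A) : A → A → Type (max u v)
  | single {w z : A} (g : w ⟶ z) : WZigzag W w z
  | cons {w y x z : A} (g : w ⟶ y) (f : x ⟶ y) (hf : PlusId W f) (t : WZigzag W x z) :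
      WZigzag W w z

namespace WZigzag

variable {A : Type u} [Category.{v} A] {W : MorphismProperty A}

/-- Precompose the first arrow of a zigzag with a morphism. -/
def precomp {v w z : A} (h : v ⟶ w) : WZigzag W w z → WZigzag W v z
  | single g => single (h ≫ g)
  | cons g f hf t => cons (h ≫ g) f hf t

/-- Concatenation of zigzags; the two adjacent forward arrows are composed. -/
def comp {v w z : A} : WZigzag W v w → WZigzag W w z → WZigzag W v z
  | single g, s => precomp g s
  | cons g f hf t, s => cons g f hf (comp t s)

/-- Two zigzags are horizontally related if one is obtained from the other by dropping an
intermediate identity and composing the two arrows next to it. -/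
inductive HRel : ∀ {w z : A}, WZigzag W w z → WZigzag W w z → Prop
  | dropBackward {w y z : A} (g : w ⟶ y) (hf : PlusId W (𝟙 y)) (t : WZigzag W y z) :
      HRel (cons g (𝟙 y) hf t) (precomp g t)
  | dropForward {w y x x' z : A} (g : w ⟶ y) (f : x ⟶ y) (f' : x' ⟶ x) (hf : PlusId W f)
      (hf' : PlusId W f') (hff : PlusId W (f' ≫ f)) (t : WZigzag W x' z) :
      HRel (cons g f hf (cons (𝟙 x) f' hf' t)) (cons g (f' ≫ f) hff t)
  | cons {w y x z : A} (g : w ⟶ y) (f : x ⟶ y) (hf : PlusId W f) {t t' : WZigzag W x z} :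
      HRel t t' → HRel (cons g f hf t) (cons g f hf t')

/-- `Ladder R v τ τ'`: the zigzags `τ` (top) and `τ'` (bottom) have the same shape and are the
rows of a diagram whose first vertical map is `v`, whose last vertical map is an identity, and
whose other vertical maps (pointing down) are in `W` or identities, such that in each square the
composite through the lower row is `R`-related to the composite through the upper row. -/
inductive Ladder (R : ∀ {a b : A}, (a ⟶ b) → (a ⟶ b) → Prop) :
    ∀ {w w' z : A}, (w ⟶ w') → WZigzag W w z → WZigzag W w' z → Prop
  | single {w w' z : A} (v : w ⟶ w') (g : w ⟶ z) (g' : w' ⟶ z) :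
      R (v ≫ g') g → Ladder R v (single g) (single g')
  | cons {w w' y y' x x' z : A} (v : w ⟶ w') (u : y ⟶ y') (v' : x ⟶ x')
      (g : w ⟶ y) (g' : w' ⟶ y') (f : x ⟶ y) (f' : x' ⟶ y')
      (hf : PlusId W f) (hf' : PlusId W f') (t : WZigzag W x z) (t' : WZigzag W x' z) :
      PlusId W u → PlusId W v' → R (v ≫ g') (g ≫ u) → R (v' ≫ f') (f ≫ u) →
      Ladder R v' t t' → Ladder R v (cons g f hf t) (cons g' f' hf' t')

/-- Two zigzags are vertically related if they are the rows of a commutative ladder. -/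
def VRel {w z : A} (τ τ' : WZigzag W w z) : Prop := Ladder (fun f g => f = g) (𝟙 w) τ τ'

/-- The generating relations between zigzags. -/
def Rel {w z : A} (τ τ' : WZigzag W w z) : Prop := HRel τ τ' ∨ VRel τ τ'

lemma precomp_precomp {a b c d : A} (g : a ⟶ b) (h : b ⟶ c) (t : WZigzag W c d) :
    precomp g (precomp h t) = precomp (g ≫ h) t := by
  cases t <;> simp [precomp]

lemma precomp_id {a b : A} (t : WZigzag W a b) : precomp (𝟙 a) t = t := by
  cases t <;> simp [precomp]

lemma precomp_comp {a b c d : A} (g : a ⟶ b) (t : WZigzag W b c) (s : WZigzag W c d) :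
    (precomp g t).comp s = precomp g (t.comp s) := by
  cases t with
  | single h => exact (precomp_precomp g h s).symm
  | cons h f hf t => rfl

lemma comp_assoc {a b c d : A} (r : WZigzag W a b) (s : WZigzag W b c) (t : WZigzag W c d) :
    (r.comp s).comp t = r.comp (s.comp t) := by
  induction r with
  | single g => exact precomp_comp g s t
  | cons g f hf r ih => simp [comp, ih]

lemma comp_id {a b : A} (t : WZigzag W a b) : t.comp (single (𝟙 b)) = t := by
  induction t with
  | single g => simp [comp, precomp]
  | cons g f hf r ih => simp [comp, ih]

lemma HRel.precomp {a b c : A} (g : a ⟶ b) {t t' : WZigzag W b c} (h : HRel t t') :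
    HRel (precomp g t) (WZigzag.precomp g t') := by
  cases h with
  | dropBackward g' hf t =>
    rw [precomp_precomp]
    exact HRel.dropBackward _ _ _
  | dropForward => exact HRel.dropForward _ _ _ _ _ _ _
  | cons _ _ _ h => exact HRel.cons _ _ _ h

lemma HRel.comp_left {a b c : A} (r : WZigzag W a b) {t t' : WZigzag W b c} (h : HRel t t') :
    HRel (r.comp t) (r.comp t') := by
  induction r with
  | single g => exact h.precomp g
  | cons g f hf r ih => exact HRel.cons _ _ _ (ih h)

lemma HRel.comp_right {a b c : A} {r r' : WZigzag W a b} (h : HRel r r') (t : WZigzag W b c) :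
    HRel (r.comp t) (r'.comp t) := by
  induction h with
  | dropBackward g hf s =>
    rw [precomp_comp]
    exact HRel.dropBackward _ _ _
  | dropForward => exact HRel.dropForward _ _ _ _ _ _ _
  | cons _ _ _ _ ih => exact HRel.cons _ _ _ (ih t)

section ladder

variable {R : ∀ {a b : A}, (a ⟶ b) → (a ⟶ b) → Prop}

lemma Ladder.refl (hR : ∀ {a b : A} (f : a ⟶ b), R f f) {a b : A} (t : WZigzag W a b) :
    Ladder R (𝟙 a) t t := by
  induction t with
  | single g => exact Ladder.single _ _ _ (by rw [Category.id_comp]; exact hR g)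
  | cons g f hf t ih =>
    exact Ladder.cons _ (𝟙 _) (𝟙 _) _ _ _ _ _ _ _ _ (PlusId.id _) (PlusId.id _)
      (by rw [Category.id_comp, Category.comp_id]; exact hR g)
      (by rw [Category.id_comp, Category.comp_id]; exact hR f) ih

lemma Ladder.comp
    (hR : ∀ {a b c : A} {f f' : a ⟶ b} {g g' : b ⟶ c}, R f f' → R g g' → R (f ≫ g) (f' ≫ g'))
    {a a' b c : A} {v : a ⟶ a'} {r : WZigzag W a b} {r' : WZigzag W a' b}
    (h : Ladder R v r r') {t t' : WZigzag W b c} (ht : Ladder R (𝟙 b) t t') :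
    Ladder R v (r.comp t) (r'.comp t') := by
  induction h with
  | single v g g' hg =>
    cases ht with
    | single _ k k' hk =>
      rw [Category.id_comp] at hk
      exact Ladder.single _ _ _ (by rw [← Category.assoc]; exact hR hg hk)
    | cons _ u v' k k' f f' hf hf' t t' hu hv' hk hff hl =>
      rw [Category.id_comp] at hk
      exact Ladder.cons _ u v' _ _ _ _ _ _ _ _ hu hv'
        (by rw [← Category.assoc, Category.assoc g]; exact hR hg hk) hff hl
  | cons v u v' g g' f f' hf hf' s s' hu hv' hg hff _ ih =>
    exact Ladder.cons _ u v' _ _ _ _ _ _ _ _ hu hv' hg hff (ih ht)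

end ladder

lemma Rel.comp_left {a b c : A} (r : WZigzag W a b) {t t' : WZigzag W b c} (h : Rel t t') :
    Rel (r.comp t) (r.comp t') :=
  h.imp (HRel.comp_left r) fun h =>
    Ladder.comp (R := fun f g => f = g) (fun h1 h2 => by rw [h1, h2])
      (Ladder.refl (fun _ => rfl) r) h

lemma Rel.comp_right {a b c : A} {r r' : WZigzag W a b} (h : Rel r r') (t : WZigzag W b c) :
    Rel (r.comp t) (r'.comp t) :=
  h.imp (fun h => h.comp_right t) fun h =>
    Ladder.comp (R := fun f g => f = g) (fun h1 h2 => by rw [h1, h2])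
      h (Ladder.refl (fun _ => rfl) t)

end WZigzag

/-- The localization of `A` at `W`: same objects as `A`. -/
structure Loc {A : Type u} [Category.{v} A] (W : MorphismProperty A) where
  obj : A

namespace Loc

/-- Morphisms of the localization are zigzags modulo the equivalence relation generated by the
horizontal and vertical relations; composition is concatenation. -/
instance category {A : Type u} [Category.{v} A] (W : MorphismProperty A) :
    Category.{max u v} (Loc W) where
  Hom a b := Quot (WZigzag.Rel (W := W) (w := a.obj) (z := b.obj))
  id a := Quot.mk _ (WZigzag.single (𝟙 a.obj))
  comp f g := Quot.map₂ WZigzag.comp (fun r _ _ h => WZigzag.Rel.comp_left r h)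
    (fun _ _ t h => WZigzag.Rel.comp_right h t) f g
  id_comp := by
    rintro a b ⟨t⟩
    exact congrArg (Quot.mk _) (WZigzag.precomp_id t)
  comp_id := by
    rintro a b ⟨t⟩
    exact congrArg (Quot.mk _) (WZigzag.comp_id t)
  assoc := by
    rintro a b c d ⟨r⟩ ⟨s⟩ ⟨t⟩
    exact congrArg (Quot.mk _) (WZigzag.comp_assoc r s t)

/-- The class of a zigzag. -/
def cls {A : Type u} [Category.{v} A] {W : MorphismProperty A} {a b : Loc W}
    (τ : WZigzag W a.obj b.obj) : a ⟶ b := Quot.mk _ τ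

variable {A : Type u} [PCategory.{v} A] {W : MorphismProperty A}

/-- `γ' ⇒ γ`: there are representatives of `γ` and `γ'` that are the top and the bottom row of a
ladder in which, in each square, (lower composite) `⇒` (upper composite). -/
def Step {a b : Loc W} (γ' γ : a ⟶ b) : Prop :=
  ∃ τ τ' : WZigzag W a.obj b.obj, cls τ = γ ∧ cls τ' = γ' ∧
    WZigzag.Ladder (fun f g => f ≤ g) (𝟙 a.obj) τ τ'

/-- The order on morphisms, the transitive closure of `Step`
(`Step` is itself reflexive). -/
def LE {a b : Loc W} (γ' γ : a ⟶ b) : Prop := Relation.ReflTransGen Step γ' γ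

lemma Step.refl {a b : Loc W} (γ : a ⟶ b) : Step γ γ := by
  obtain ⟨t⟩ := γ
  exact ⟨t, t, rfl, rfl, WZigzag.Ladder.refl (fun _ => le_rfl) t⟩

lemma Step.comp {a b c : Loc W} {f f' : a ⟶ b} {g g' : b ⟶ c} (hf : Step f f')
    (hg : Step g g') : Step (f ≫ g) (f' ≫ g') := by
  obtain ⟨t, t', rfl, rfl, ht⟩ := hf
  obtain ⟨s, s', rfl, rfl, hs⟩ := hg
  exact ⟨t.comp s, t'.comp s', rfl, rfl, ht.comp PCategory.comp_le_comp hs⟩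

lemma LE.comp {a b c : Loc W} {f f' : a ⟶ b} {g g' : b ⟶ c} (hf : LE f f')
    (hg : LE g g') : LE (f ≫ g) (f' ≫ g') := by
  have h1 : LE (f ≫ g) (f' ≫ g) := by
    induction hf with
    | refl => exact Relation.ReflTransGen.refl
    | tail _ h ih => exact ih.tail (h.comp (Step.refl g))
  have h2 : LE (f' ≫ g) (f' ≫ g') := by
    induction hg with
    | refl => exact Relation.ReflTransGen.refl
    | tail _ h ih => exact ih.tail ((Step.refl f').comp h)
  exact h1.trans h2

/-- An additive length on morphisms that is strictly monotone for `⇒` and that on `W` is the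
difference of a degree function on objects. It is used to see that `LE` is antisymmetric. -/
structure Length (W : MorphismProperty A) where
  len : ∀ {a b : A}, (a ⟶ b) → ℤ
  deg : A → ℤ
  len_comp : ∀ {a b c : A} (f : a ⟶ b) (g : b ⟶ c), len (f ≫ g) = len f + len g
  len_mono : ∀ {a b : A} {f g : a ⟶ b}, f ≤ g → len f ≤ len g
  eq_of_len : ∀ {a b : A} {f g : a ⟶ b}, f ≤ g → len f = len g → f = g
  len_W : ∀ {a b : A} (f : a ⟶ b), W f → len f = deg a - deg b

namespace Length

variable (L : Length W)

lemma len_id (a : A) : L.len (𝟙 a) = 0 := by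
  have h := L.len_comp (𝟙 a) (𝟙 a)
  rw [Category.id_comp] at h
  lia

lemma len_plus {a b : A} {f : a ⟶ b} (hf : PlusId W f) : L.len f = L.deg a - L.deg b := by
  cases hf with
  | id => rw [L.len_id]; ring
  | of _ hf => exact L.len_W f hf

/-- The signed length of a zigzag. -/
def zig {a b : A} : WZigzag W a b → ℤ
  | .single g => L.len g
  | .cons g f _ t => L.len g - L.len f + zig t

lemma zig_precomp {a b c : A} (g : a ⟶ b) (t : WZigzag W b c) :
    L.zig (t.precomp g) = L.len g + L.zig t := by
  cases t <;> simp [WZigzag.precomp, zig, L.len_comp]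
  ring

lemma zig_hrel {a b : A} {t t' : WZigzag W a b} (h : WZigzag.HRel t t') : L.zig t = L.zig t' := by
  induction h with
  | dropBackward g hf t => rw [zig_precomp]; simp [zig, L.len_id]
  | dropForward => simp [zig, L.len_id, L.len_comp]; ring
  | cons _ _ _ _ ih => simp [zig, ih]

lemma zig_ladder {a a' b : A} {v : a ⟶ a'} {t : WZigzag W a b} {t' : WZigzag W a' b}
    (h : WZigzag.Ladder (fun f g => f ≤ g) v t t') :
    L.len v + L.zig t' ≤ L.zig t ∧
      (L.len v + L.zig t' = L.zig t → WZigzag.Ladder (fun f g => f = g) v t t') := by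
  induction h with
  | single v g g' hg =>
    have h1 := L.len_mono hg
    have h2 := L.len_comp v g'
    refine ⟨by simp only [zig]; lia, fun h => ?_⟩
    simp only [zig] at h
    exact WZigzag.Ladder.single _ _ _ (L.eq_of_len hg (by lia))
  | cons v u v' g g' f f' hf hf' t t' hu hv' hg hff hl ih =>
    have h1 := L.len_mono hg
    rw [L.len_comp, L.len_comp] at h1
    have h2 : L.len (v' ≫ f') = L.len (f ≫ u) := by
      rw [L.len_comp, L.len_comp, L.len_plus hf, L.len_plus hf', L.len_plus hu, L.len_plus hv']
      ring
    have h3 := h2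
    rw [L.len_comp, L.len_comp] at h3
    obtain ⟨ih1, ih2⟩ := ih
    refine ⟨by simp only [zig]; lia, fun h => ?_⟩
    simp only [zig] at h
    refine WZigzag.Ladder.cons _ u v' _ _ _ _ _ _ _ _ hu hv' (L.eq_of_len hg ?_)
      (L.eq_of_len hff h2) (ih2 (by lia))
    rw [L.len_comp, L.len_comp]
    lia

lemma zig_vrel {a a' b : A} {v : a ⟶ a'} {t : WZigzag W a b} {t' : WZigzag W a' b}
    (h : WZigzag.Ladder (fun f g => f = g) v t t') : L.len v + L.zig t' = L.zig t := by
  induction h with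
  | single v g g' hg => simp only [zig]; rw [← hg, L.len_comp]
  | cons v u v' g g' f f' hf hf' t t' hu hv' hg hff hl ih =>
    have h1 := congrArg L.len hg
    have h2 := congrArg L.len hff
    rw [L.len_comp, L.len_comp] at h1 h2
    simp only [zig]
    lia

/-- The signed length of a morphism of the localization. -/
def quot {a b : Loc W} (γ : a ⟶ b) : ℤ :=
  Quot.lift L.zig (by
    rintro t t' (h | h)
    · exact L.zig_hrel h
    · have := L.zig_vrel h
      rw [L.len_id] at this
      lia) γ

lemma step {a b : Loc W} {γ γ' : a ⟶ b} (h : Step γ γ') :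
    L.quot γ ≤ L.quot γ' ∧ (L.quot γ = L.quot γ' → γ = γ') := by
  obtain ⟨t, t', rfl, rfl, h⟩ := h
  have h1 := L.zig_ladder h
  rw [L.len_id, zero_add] at h1
  refine ⟨h1.1, fun h2 => ?_⟩
  have h3 : WZigzag.Rel t t' := Or.inr (h1.2 h2)
  exact (Quot.sound h3).symm

lemma le {a b : Loc W} {γ γ' : a ⟶ b} (h : LE γ γ') :
    L.quot γ ≤ L.quot γ' ∧ (L.quot γ = L.quot γ' → γ = γ') := by
  induction h with
  | refl => exact ⟨le_rfl, fun _ => rfl⟩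
  | tail _ h ih =>
    have h1 := L.step h
    refine ⟨ih.1.trans h1.1, fun h2 => ?_⟩
    rw [ih.2 (by have := ih.1; have := h1.1; lia)]
    exact h1.2 (by have := ih.1; have := h1.1; lia)

/-- The localization is a p-category. -/
@[reducible]
def pCategory : PCategory.{max u v} (Loc W) where
  toCategory := Loc.category W
  homPartialOrder a b :=
    { le := LE
      le_refl := fun _ => Relation.ReflTransGen.refl
      le_trans := fun _ _ _ => Relation.ReflTransGen.trans
      le_antisymm := fun _ _ h1 h2 => (L.le h1).2 (le_antisymm (L.le h1).1 (L.le h2).1) }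
  comp_le_comp := LE.comp

end Length

end Loc

/-! ### The entrance path category -/

/-- A strictly descending sequence `x = x₀ > x₁ > ⋯ > x_k = y`; `tail` is `x₁, …, x_k`. -/
@[ext]
structure EntrancePath {P : Type u} [Preorder P] (x y : P) where
  tail : List P
  chain : List.IsChain (fun a b => b < a) (x :: tail)
  last : (x :: tail).getLast (List.cons_ne_nil x tail) = y

/-- All cells of the sequence. -/
def EntrancePath.cells {P : Type u} [Preorder P] {x y : P} (f : EntrancePath x y) : List P :=
  x :: f.tail

/-- The objects of the entrance path category of (the cells of a complex with face relation)
`P`. -/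
structure Ent (P : Type u) where
  cell : P

lemma EntrancePath.isChain_append {P : Type u} [Preorder P] {x y z : P} (f : EntrancePath x y)
    (g : EntrancePath y z) : List.IsChain (fun a b => b < a) (x :: (f.tail ++ g.tail)) := by
  rw [← List.cons_append, List.isChain_append]
  refine ⟨f.chain, g.chain.tail, ?_⟩
  intro a ha b hb
  have h1 : a = y := by
    rw [List.getLast?_eq_getLast_of_ne_nil (List.cons_ne_nil _ _), f.last] at ha
    simpa using ha.symm
  subst h1
  have h2 := g.chain
  cases hg : g.tail with
  | nil => simp [hg] at hb
  | cons c l =>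
    rw [hg] at hb h2
    simp only [List.head?_cons, Option.mem_some_iff] at hb
    subst hb
    exact (List.isChain_cons_cons.1 h2).1

lemma EntrancePath.getLast_append {P : Type u} [Preorder P] {x y z : P} (f : EntrancePath x y)
    (g : EntrancePath y z) :
    (x :: (f.tail ++ g.tail)).getLast (List.cons_ne_nil _ _) = z := by
  have hg := g.last
  cases h : g.tail with
  | nil =>
    simp only [h, List.getLast_singleton] at hg
    simp only [List.append_nil]
    rw [f.last, hg]
  | cons c l =>
    simp only [h] at hg
    rw [← hg]
    simp [List.getLast_cons]

/-- The entrance path category: morphisms are strictly descending sequences, composition is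
concatenation, and `f ⇒ f'` iff `f` is a subsequence of `f'`. -/
instance Ent.pCategory (P : Type u) [Preorder P] : PCategory.{u} (Ent P) where
  Hom x y := EntrancePath x.cell y.cell
  id x := ⟨[], List.isChain_singleton _, rfl⟩
  comp f g := ⟨f.tail ++ g.tail, f.isChain_append g, f.getLast_append g⟩
  id_comp f := rfl
  comp_id f := EntrancePath.ext (List.append_nil _)
  assoc f g h := EntrancePath.ext (List.append_assoc _ _ _)
  homPartialOrder x y :=
    { le := fun f f' => f.cells.Sublist f'.cells
      le_refl := fun f => List.Sublist.refl _
      le_trans := fun _ _ _ => List.Sublist.trans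
      le_antisymm := fun _ _ h1 h2 => EntrancePath.ext (List.cons_injective (h1.antisymm h2)) }
  comp_le_comp hf hg := List.Sublist.append hf (List.cons_sublist_cons.1 hg)

/-! ### Regular CW complexes and discrete Morse functions -/

/-- A CW complex is regular if every attaching map is a homeomorphism onto its image. -/
def IsRegularCW {X : Type u} [TopologicalSpace X] (C : Set X) [Topology.CWComplex C] : Prop :=
  ∀ (n : ℕ) (i : Topology.RelCWComplex.cell C n),
    Topology.IsEmbedding fun x : Metric.sphere (0 : Fin n → ℝ) 1 => Topology.RelCWComplex.map n i x.1

/-- The cells of a CW complex, of all dimensions. -/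
structure CWCell {X : Type u} [TopologicalSpace X] (C : Set X) [Topology.CWComplex C] where
  dim : ℕ
  idx : Topology.RelCWComplex.cell C dim

namespace CWCell

variable {X : Type u} [TopologicalSpace X] {C : Set X} [Topology.CWComplex C]

/-- The closed cell, as a subset of the complex. -/
def closed (x : CWCell C) : Set X := Topology.RelCWComplex.closedCell x.dim x.idx

/-- The face relation: `x ≤ y` iff the closed cell `x` is contained in the closed cell `y`. -/
instance : Preorder (CWCell C) := Preorder.lift closed

/-- `{x, y}` is a regular pair of `φ`: `x` is a face of `y` of codimension one and
`φ x ≥ φ y`. -/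
def RegularPair (φ : CWCell C → ℝ) (x y : CWCell C) : Prop :=
  y.dim = x.dim + 1 ∧ x ≤ y ∧ φ y ≤ φ x

/-- Discrete Morse functions. -/
structure IsDiscreteMorse (φ : CWCell C → ℝ) : Prop where
  up : ∀ x y y' : CWCell C, y.dim = x.dim + 1 → y'.dim = x.dim + 1 → x ≤ y → x ≤ y' →
    φ y ≤ φ x → φ y' ≤ φ x → y = y'
  down : ∀ x y y' : CWCell C, x.dim = y.dim + 1 → x.dim = y'.dim + 1 → y ≤ x → y' ≤ x →
    φ x ≤ φ y → φ x ≤ φ y' → y = y'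

/-- Critical cells: the cells that belong to no regular pair. -/
def IsCritical (φ : CWCell C → ℝ) (x : CWCell C) : Prop :=
  (¬ ∃ y : CWCell C, y.dim = x.dim + 1 ∧ x ≤ y ∧ φ y ≤ φ x) ∧
  (¬ ∃ y : CWCell C, x.dim = y.dim + 1 ∧ y ≤ x ∧ φ x ≤ φ y)

/-- The Morse system induced by `φ`: the entrance paths `(y > x)` with `{x, y}` a regular
pair. -/
def morseSystem (φ : CWCell C → ℝ) : MorphismProperty (Ent (CWCell C)) :=
  fun y x f => EntrancePath.cells f = [y.cell, x.cell] ∧ RegularPair φ x.cell y.cell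

/-- The number of steps of an entrance path is a length for the Morse system. -/
def morseLength (φ : CWCell C → ℝ) : Loc.Length (morseSystem φ) where
  len f := (EntrancePath.tail f).length
  deg x := x.cell.dim
  len_comp f g := by
    change ((EntrancePath.tail f ++ EntrancePath.tail g).length : ℤ) = _
    simp
  len_mono h := by
    have := List.Sublist.length_le (List.cons_sublist_cons.1 h)
    exact_mod_cast this
  eq_of_len h h' :=
    EntrancePath.ext (List.Sublist.eq_of_length (List.cons_sublist_cons.1 h) (by exact_mod_cast h'))
  len_W {a b} f hf := by
    have h1 : EntrancePath.tail f = [b.cell] := List.cons_injective hf.1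
    rw [h1, hf.2.1]
    simp

/-- The localization of the entrance path category at the Morse system. -/
instance (φ : CWCell C → ℝ) : PCategory.{u} (Loc (morseSystem φ)) :=
  Loc.Length.pCategory (morseLength φ)

end CWCell

/-- The discrete flow category of `φ`: the full subcategory of the localization of the entrance
path category at the Morse system on the critical cells. -/
structure Flo {X : Type u} [TopologicalSpace X] {C : Set X} [Topology.CWComplex C]
    (φ : CWCell C → ℝ) where
  cell : CWCell C
  critical : CWCell.IsCritical φ cell

/-- The object of the localization given by an object of the discrete flow category. -/
def Flo.toLoc {X : Type u} [TopologicalSpace X] {C : Set X} [Topology.CWComplex C]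
    {φ : CWCell C → ℝ} (x : Flo φ) : Loc (CWCell.morseSystem φ) := ⟨⟨x.cell⟩⟩

instance Flo.pCategory {X : Type u} [TopologicalSpace X] {C : Set X} [Topology.CWComplex C]
    (φ : CWCell C → ℝ) : PCategory.{u} (Flo φ) where
  Hom x y := x.toLoc ⟶ y.toLoc
  id x := 𝟙 x.toLoc
  comp f g := CategoryStruct.comp (obj := Loc (CWCell.morseSystem φ)) f g
  id_comp f := Category.id_comp (obj := Loc (CWCell.morseSystem φ)) f
  comp_id f := Category.comp_id (obj := Loc (CWCell.morseSystem φ)) f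
  assoc f g h := Category.assoc (obj := Loc (CWCell.morseSystem φ)) f g h
  homPartialOrder x y := PCategory.homPartialOrder x.toLoc y.toLoc
  comp_le_comp hf hg := PCategory.comp_le_comp (A := Loc (CWCell.morseSystem φ)) hf hg

/-!
Regular pairs of a discrete Morse function `φ` are disjoint. That a cell is not at the same time the
upper part of one pair and the lower part of another is the only topological input: in a regular
complex a face of codimension two lies in at least two of the intermediate faces
(`CWCell.exists_ne_between`), a consequence of invariance of domain (`isOpen_image_of_injOn`), which
is proved from the absence of `C¹` retractions of a ball onto its boundary. Regularity ensures that
characteristic maps have continuous inverses, so that open pieces of the boundary sphere of a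
`(k+1)`-cell are mapped injectively into `k`-dimensional space.

Since the regular pairs are disjoint, every morphism of the localization has a normal form: its list
of steps which are not regular pairs, where the isomorphisms inserted between them are determined
by their ends. The list depends on the morphism only, because it defines a functor to a free monoid
that is trivial on the Morse system. Hence two factorizations of a morphism through critical cells
are comparable (`CWCell.exists_comparison`), and nonidentity morphisms between critical cells lower
the dimension. So the discrete flow category is free on a graph. Its order is generated by the insertion
of a cell into a step, so that factorizations lift along the order (`CWCell.exists_lift`), and the
categories of chains `f₀ ⇒ ⋯ ⇒ fₙ` are free as well (`IsDirectLevi.nLevel`).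

The chain complex of the nerve of a free category is exact in degrees at least two. The contracting
homotopy is a version of Fox calculus: if `m` has the indecomposable factors `α₁, …, αₖ`, then the
sum of the simplices that begin with `αᵢ` followed by `αᵢ₊₁ ⋯ αₖ` has a telescoping boundary
(`IsDirectLevi.nerveBoundary_homotopy`). Therefore the first page is concentrated in the rows `0`
and `1`. The row `q = 0` of the double complex is the chain complex of a constant simplicial set,
which gives the vanishing in that row of the second page (`subsingleton_E_two_doubleNerve`). Every
differential from the second page on has then a source or a target that is zero.
-/

/-! ### Invariance of domain -/

section invarianceOfDomain

open MeasureTheory Set Metric Topology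

/-- A left inverse of a continuous map on a compact set is continuous on the image. -/
lemma continuousOn_image_of_leftInvOn {X Y : Type*} [TopologicalSpace X] [TopologicalSpace Y]
    [T2Space Y] {K : Set X} (hK : IsCompact K) {f : X → Y} {g : Y → X} (hf : ContinuousOn f K)
    (hg : LeftInvOn g f K) : ContinuousOn g (f '' K) := by
  rw [continuousOn_iff_isClosed]
  intro t ht
  refine ⟨f '' (K ∩ t), ((hK.inter_right ht).image_of_continuousOn
    (hf.mono inter_subset_left)).isClosed, ?_⟩
  ext y
  constructor
  · rintro ⟨hy, x, hx, rfl⟩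
    rw [mem_preimage, hg hx] at hy
    exact ⟨⟨x, ⟨hx, hy⟩, rfl⟩, x, hx, rfl⟩
  · rintro ⟨⟨x, ⟨hx, hxt⟩, rfl⟩, hy⟩
    exact ⟨by rwa [mem_preimage, hg hx], hy⟩

section innerProduct

variable {E : Type*} [NormedAddCommGroup E] [InnerProductSpace ℝ E] [FiniteDimensional ℝ E]

lemma exists_polynomial_det_one_add_smul (A : E →L[ℝ] E) :
    ∃ P : Polynomial ℝ, P.natDegree ≤ Module.finrank ℝ E ∧
      ∀ t : ℝ, P.eval t = (ContinuousLinearMap.id ℝ E + t • A).det := by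
  classical
  let b := Module.finBasis ℝ E
  let M := LinearMap.toMatrix b b (A : E →ₗ[ℝ] E)
  refine ⟨((Polynomial.X : Polynomial ℝ) • M.map Polynomial.C +
    (1 : Matrix (Fin (Module.finrank ℝ E)) (Fin (Module.finrank ℝ E)) ℝ).map Polynomial.C).det,
    ?_, fun t => ?_⟩
  · have h := Polynomial.natDegree_det_X_add_C_le M 1
    rwa [Fintype.card_fin] at h
  · have h : LinearMap.toMatrix b b
        ((ContinuousLinearMap.id ℝ E + t • A : E →L[ℝ] E) : E →ₗ[ℝ] E) = 1 + t • M := by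
      rw [ContinuousLinearMap.toLinearMap_add, ContinuousLinearMap.toLinearMap_smul, map_add,
        map_smul, ContinuousLinearMap.coe_id, LinearMap.toMatrix_id]
    rw [ContinuousLinearMap.det, ← LinearMap.det_toMatrix b, h, ← Polynomial.coe_evalRingHom,
      RingHom.map_det]
    congr 1
    ext i j
    by_cases hij : i = j <;> simp [hij] <;> ring

/-- The determinants `det (1 + t A)` for small `t` control the one for `t = 1`, linearly and
uniformly in `A`, by Lagrange interpolation. -/
lemma exists_interpolation_det {ε : ℝ} (hε : 0 < ε) :
    ∃ (s : Finset ℝ) (c : ℝ → ℝ), (∀ t ∈ s, 0 < t ∧ t < ε) ∧ ∑ t ∈ s, c t = 1 ∧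
      ∀ A : E →L[ℝ] E, (ContinuousLinearMap.id ℝ E + A).det =
        ∑ t ∈ s, c t * (ContinuousLinearMap.id ℝ E + t • A).det := by
  classical
  obtain ⟨s, hs, hcard⟩ := (Set.Ioo_infinite hε).exists_subset_card_eq (Module.finrank ℝ E + 1)
  have hinj : Set.InjOn (id : ℝ → ℝ) s := Set.injOn_id _
  refine ⟨s, fun t => (Lagrange.basis s id t).eval 1, fun t ht => hs ht, ?_, fun A => ?_⟩
  · rw [← Polynomial.eval_finsetSum, Lagrange.sum_basis hinj, Polynomial.eval_one]
    rw [← Finset.card_pos, hcard]; omega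
  · obtain ⟨P, hP, hPt⟩ := exists_polynomial_det_one_add_smul A
    have h1 : P.degree < s.card := by
      rw [hcard]
      exact lt_of_le_of_lt Polynomial.degree_le_natDegree (by exact_mod_cast Nat.lt_succ_of_le hP)
    have h2 := congrArg (Polynomial.eval 1) (Lagrange.eq_interpolate hinj h1)
    rw [hPt, one_smul] at h2
    rw [h2, Lagrange.interpolate_apply, Polynomial.eval_finsetSum]
    refine Finset.sum_congr rfl fun t _ => ?_
    rw [Polynomial.eval_mul, Polynomial.eval_C, ← hPt, mul_comm]; rfl

/-- Since the ball is connected, a map of the closed ball that is open on the open ball and fixes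
the boundary sphere is onto. -/
lemma image_ball_eq_ball {f : E → E} (hc : ContinuousOn f (closedBall 0 1))
    (hmaps : ∀ x ∈ ball (0 : E) 1, f x ∈ ball (0 : E) 1)
    (hid : ∀ x ∈ sphere (0 : E) 1, f x = x)
    (hopen : ∀ x ∈ ball (0 : E) 1, f '' ball 0 1 ∈ 𝓝 (f x)) : f '' ball 0 1 = ball 0 1 := by
  have himg : f '' ball 0 1 = f '' closedBall 0 1 ∩ ball 0 1 := by
    apply subset_antisymm
    · rintro _ ⟨x, hx, rfl⟩
      exact ⟨⟨x, ball_subset_closedBall hx, rfl⟩, hmaps x hx⟩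
    · rintro _ ⟨⟨x, hx, rfl⟩, hy⟩
      rcases (mem_closedBall.1 hx).lt_or_eq with h | h
      · exact ⟨x, h, rfl⟩
      · rw [hid x h] at hy
        exact absurd (mem_ball.1 hy) (by rw [h]; exact lt_irrefl _)
  apply subset_antisymm
  · rintro _ ⟨x, hx, rfl⟩; exact hmaps x hx
  · have hU : IsOpen (f '' ball 0 1) := by
      rw [isOpen_iff_mem_nhds]
      rintro _ ⟨x, hx, rfl⟩; exact hopen x hx
    have hcl : IsClosed (f '' closedBall 0 1) :=
      ((isCompact_closedBall (0 : E) 1).image_of_continuousOn hc).isClosed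
    refine IsPreconnected.subset_of_closure_inter_subset
      (convex_ball (0 : E) 1).isPreconnected hU ?_ ?_
    · exact ⟨f 0, hmaps 0 (by simp), 0, by simp, rfl⟩
    · rintro y ⟨hy, hyb⟩
      rw [himg]
      refine ⟨?_, hyb⟩
      exact closure_minimal (image_mono ball_subset_closedBall) hcl hy

lemma det_eq_zero_of_inner_eq_zero {A : E →L[ℝ] E} {w : E} (hw : w ≠ 0)
    (h : ∀ v, inner ℝ w (A v) = 0) : A.det = 0 := by
  by_contra hd
  have hd' : LinearMap.det (A : E →ₗ[ℝ] E) ≠ 0 := hd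
  have hu := (LinearMap.isUnit_iff_isUnit_det (A : E →ₗ[ℝ] E)).2 (isUnit_iff_ne_zero.2 hd')
  obtain ⟨v, hv⟩ := ((Module.End.isUnit_iff _).1 hu).2 w
  have := h v
  change A v = w at hv
  rw [hv] at this
  exact hw (inner_self_eq_zero.1 this)

variable [MeasurableSpace E] [BorelSpace E]

/-- There is no `C¹` retraction `r` onto the unit sphere. Along `x ↦ (1 - t) x + t r(x)` the
integral of the Jacobian over the ball is a polynomial in `t`. It is the volume of the ball for
small `t`, as the map is then a bijection of the ball, but it vanishes for `t = 1`. -/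
theorem no_contDiff_retraction {r : E → E} (hr : ContDiff ℝ 1 r) (hr1 : ∀ x, ‖r x‖ = 1)
    (hid : ∀ x ∈ sphere (0 : E) 1, r x = x) : False := by
  set g : E → E := fun x => r x - x with hg
  have hgc : ContDiff ℝ 1 g := hr.sub contDiff_id
  have hgd : ∀ x, HasStrictFDerivAt g (fderiv ℝ g x) x := fun x =>
    hgc.contDiffAt.hasStrictFDerivAt one_ne_zero
  have hrd : ∀ x, HasFDerivAt r (fderiv ℝ r x) x := fun x =>
    (hr.differentiable one_ne_zero x).hasFDerivAt
  have hgr : ∀ x, fderiv ℝ g x = fderiv ℝ r x - ContinuousLinearMap.id ℝ E := fun x =>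
    ((hrd x).sub (hasFDerivAt_id x)).fderiv
  obtain ⟨Cc, hC⟩ := hgc.contDiffOn.exists_lipschitzOnWith one_ne_zero
    (convex_closedBall (0 : E) 1) (isCompact_closedBall (0 : E) 1)
  have hcont : Continuous fun z : ℝ × E =>
      (ContinuousLinearMap.id ℝ E + z.1 • fderiv ℝ g z.2).det := by
    refine ContinuousLinearMap.continuous_det.comp ?_
    exact continuous_const.add (continuous_fst.smul
      ((hgc.continuous_fderiv one_ne_zero).comp continuous_snd))
  -- for small `t` the map `x ↦ x + t g(x)` is a bijection of the ball with positive Jacobian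
  have hpos : ∀ᶠ t : ℝ in 𝓝 0, ∀ x ∈ closedBall (0 : E) 1,
      0 < (ContinuousLinearMap.id ℝ E + t • fderiv ℝ g x).det := by
    refine (isCompact_closedBall (0 : E) 1).eventually_forall_of_forall_eventually fun x _ => ?_
    refine hcont.continuousAt.eventually (lt_mem_nhds ?_)
    simp [ContinuousLinearMap.det]
  have hsmall : ∀ᶠ t : ℝ in 𝓝 0, t * Cc < 1 ∧ t < 1 := by
    refine ((continuous_id.mul continuous_const).continuousAt.eventually
      (gt_mem_nhds ?_)).and (gt_mem_nhds one_pos)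
    simp
  obtain ⟨ε, hε, hball⟩ := Metric.eventually_nhds_iff.1 (hpos.and hsmall)
  have hvol : ∀ t, 0 < t → t < ε →
      ∫ x in ball (0 : E) 1, (ContinuousLinearMap.id ℝ E + t • fderiv ℝ g x).det
        = volume.real (ball (0 : E) 1) := by
    intro t ht htε
    obtain ⟨hdet, htC, ht1⟩ := hball (y := t) (by rw [Real.dist_0_eq_abs, abs_of_pos ht]; exact htε)
    have hfd : ∀ x, HasStrictFDerivAt (fun x => x + t • g x)
        (ContinuousLinearMap.id ℝ E + t • fderiv ℝ g x) x := fun x =>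
      (hasStrictFDerivAt_id x).add ((hgd x).const_smul t)
    have hinj : InjOn (fun x => x + t • g x) (closedBall (0 : E) 1) := by
      intro x hx y hy hxy
      by_contra hne
      have h1 : x - y = t • (g y - g x) := by
        rw [smul_sub]
        simp only at hxy
        rw [sub_eq_sub_iff_add_eq_add, hxy]; abel
      have h2 : ‖x - y‖ ≤ t * (Cc * ‖x - y‖) := by
        conv_lhs => rw [h1, norm_smul, Real.norm_of_nonneg ht.le]
        have := hC.norm_sub_le hy hx
        rw [norm_sub_rev y x] at this
        gcongr
      have h3 : 0 < ‖x - y‖ := norm_pos_iff.2 (sub_ne_zero.2 hne)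
      nlinarith
    have himg : (fun x => x + t • g x) '' ball 0 1 = ball (0 : E) 1 := by
      apply image_ball_eq_ball
      · exact (continuous_id.add (hgc.continuous.const_smul t)).continuousOn
      · intro x hx
        rw [mem_ball_zero_iff] at hx ⊢
        have h1 : x + t • g x = (1 - t) • x + t • r x := by
          simp only [hg]; rw [smul_sub, sub_smul, one_smul]; abel
        rw [h1]
        calc ‖(1 - t) • x + t • r x‖ ≤ ‖(1 - t) • x‖ + ‖t • r x‖ := norm_add_le _ _
          _ = (1 - t) * ‖x‖ + t := by
            rw [norm_smul, norm_smul, hr1, Real.norm_of_nonneg ht.le,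
              Real.norm_of_nonneg (by linarith), mul_one]
          _ < 1 := by nlinarith
      · intro x hx
        simp [hg, hid x hx]
      · intro x hx
        have hd := (hdet x (ball_subset_closedBall hx)).ne'
        have h1 := (hfd x)
        rw [← ContinuousLinearMap.coe_toContinuousLinearEquivOfDetNeZero _ hd] at h1
        rw [← h1.map_nhds_eq_of_equiv]
        exact Filter.image_mem_map (isOpen_ball.mem_nhds hx)
    have h := integral_image_eq_integral_abs_det_fderiv_smul (volume : Measure E)
      measurableSet_ball (fun x _ => (hfd x).hasFDerivAt.hasFDerivWithinAt)
      (hinj.mono ball_subset_closedBall) (fun _ => (1 : ℝ))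
    rw [himg] at h
    simp only [smul_eq_mul, mul_one, integral_const, measureReal_restrict_apply_univ] at h
    rw [h]
    refine setIntegral_congr_fun measurableSet_ball fun x hx => ?_
    exact (abs_of_pos (hdet x (ball_subset_closedBall hx))).symm
  -- the volume is a polynomial in `t`, so the formula also holds for `t = 1`
  obtain ⟨s, c, hs, hc1, hc⟩ := exists_interpolation_det (E := E) hε
  have hint : ∀ t : ℝ, IntegrableOn
      (fun x => (ContinuousLinearMap.id ℝ E + t • fderiv ℝ g x).det) (ball (0 : E) 1) := by
    intro t
    refine IntegrableOn.mono_set ?_ ball_subset_closedBall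
    exact (hcont.comp (Continuous.prodMk_right t)).continuousOn.integrableOn_compact
      (isCompact_closedBall _ _)
  have h1 : ∫ x in ball (0 : E) 1, (ContinuousLinearMap.id ℝ E + fderiv ℝ g x).det
      = volume.real (ball (0 : E) 1) := by
    rw [setIntegral_congr_fun measurableSet_ball fun x _ => hc (fderiv ℝ g x)]
    rw [integral_finsetSum _ fun t _ => (hint t).const_mul (c t)]
    simp_rw [integral_const_mul]
    rw [Finset.sum_congr rfl fun t ht => by rw [hvol t (hs t ht).1 (hs t ht).2],
      ← Finset.sum_mul, hc1, one_mul]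
  have h2 : ∀ x, (ContinuousLinearMap.id ℝ E + fderiv ℝ g x).det = 0 := by
    intro x
    rw [hgr, add_sub_cancel]
    have hx : r x ≠ 0 := by
      rw [← norm_pos_iff, hr1]; exact one_pos
    refine det_eq_zero_of_inner_eq_zero hx fun v => ?_
    have h3 : HasFDerivAt (fun x => inner ℝ (r x) (r x)) _ x := (hrd x).inner ℝ (hrd x)
    have h4 : (fun x => inner ℝ (r x) (r x)) = fun _ => (1 : ℝ) := by
      funext y; rw [real_inner_self_eq_norm_sq, hr1, one_pow]
    -- differentiating `‖r‖² = 1` shows that the image of the derivative of `r` is orthogonal to `r`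
    rw [h4] at h3
    have h5 := congrArg (fun F => F v) (h3.unique (hasFDerivAt_const (1 : ℝ) x))
    simp only [ContinuousLinearMap.comp_apply, ContinuousLinearMap.prod_apply,
      fderivInnerCLM_apply, zero_apply] at h5
    rw [real_inner_comm] at h5
    rw [real_inner_comm]
    linarith
  simp only [h2, integral_zero] at h1
  have h3 : 0 < volume.real (ball (0 : E) 1) :=
    ENNReal.toReal_pos (measure_ball_pos _ _ one_pos).ne' measure_ball_lt_top.ne
  linarith

/-- A stable form of Brouwer's theorem: a continuous map of the ball which is close to the identity
has a zero. -/
theorem exists_zero_of_close_to_id {H : E → E} (hc : ContinuousOn H (closedBall 0 1))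
    (hH : ∀ x ∈ closedBall (0 : E) 1, ‖H x - x‖ ≤ 1 / 4) :
    ∃ x ∈ closedBall (0 : E) 1, H x = 0 := by
  by_contra! hne
  obtain ⟨G, hG⟩ := ContinuousMap.exists_restrict_eq (isClosed_closedBall (x := (0 : E)) (ε := 1))
    ⟨_, hc.domRestrict⟩
  replace hG : ∀ x ∈ closedBall (0 : E) 1, G x = H x := fun x hx =>
    congrArg (fun F => F ⟨x, hx⟩) hG
  -- interpolate between `H` near the centre and the identity near the boundary
  set χ : E → ℝ := fun x => max 0 (min 1 (3 - 4 * ‖x‖)) with hχ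
  have hχ0 : ∀ x, 0 ≤ χ x := fun x => le_max_left _ _
  have hχ1 : ∀ x, χ x ≤ 1 := fun x => max_le zero_le_one (min_le_left _ _)
  set K : E → E := fun x => x + χ x • (G x - x) with hK
  have hKc : Continuous K := by
    have : Continuous χ := by fun_prop
    exact continuous_id.add (this.smul (G.continuous.sub continuous_id))
  have hKid : ∀ x : E, 3 / 4 ≤ ‖x‖ → K x = x := by
    intro x hx
    have : χ x = 0 := max_eq_left ((min_le_right _ _).trans (by linarith))
    simp [hK, this]
  have hK0 : ∀ x, K x ≠ 0 := by
    intro x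
    rcases le_total ‖x‖ (1 / 2) with hx | hx
    · have h1 : χ x = 1 := by
        simp only [hχ]
        rw [min_eq_left (by linarith), max_eq_right zero_le_one]
      have hx1 : x ∈ closedBall (0 : E) 1 := mem_closedBall_zero_iff.2 (by linarith)
      simp only [hK, h1, one_smul, add_sub_cancel]
      rw [hG x hx1]
      exact hne x hx1
    · rcases le_total ‖x‖ (3 / 4) with hx' | hx'
      · have hx1 : x ∈ closedBall (0 : E) 1 := mem_closedBall_zero_iff.2 (by linarith)
        intro h0
        have h1 : ‖K x - x‖ ≤ 1 / 4 := by
          simp only [hK, add_sub_cancel_left]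
          rw [norm_smul, Real.norm_of_nonneg (hχ0 x), hG x hx1]
          have := hH x hx1
          nlinarith [hχ0 x, hχ1 x, norm_nonneg (H x - x)]
        rw [h0, zero_sub, norm_neg] at h1
        linarith
      · rw [hKid x hx', ← norm_pos_iff]
        linarith
  obtain ⟨L, hLs, hLd, hLe, -⟩ := hKc.exists_contDiff_approx_and_eqOn 1 hKc.norm
    (fun x => norm_pos_iff.2 (hK0 x)) (S := {x | 1 ≤ ‖x‖}) (U := {x | 3 / 4 < ‖x‖})
    (isClosed_le continuous_const continuous_norm)
    ((isOpen_lt continuous_const continuous_norm).mem_nhdsSet.2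
      fun x (hx : 1 ≤ ‖x‖) => by simp only [mem_ofPred_eq]; linarith)
    (contDiffOn_id.congr fun x hx => hKid x (le_of_lt hx))
  have hL0 : ∀ x, L x ≠ 0 := by
    intro x h
    have := hLd x
    rw [h, dist_zero_left] at this
    exact lt_irrefl _ this
  refine no_contDiff_retraction (r := fun x => ‖L x‖⁻¹ • L x) ?_ ?_ ?_
  · exact ((hLs.norm ℝ hL0).inv fun x => (norm_pos_iff.2 (hL0 x)).ne').smul hLs
  · intro x
    rw [norm_smul, norm_inv, norm_norm, inv_mul_cancel₀ (norm_pos_iff.2 (hL0 x)).ne']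
  · intro x hx
    have hx1 : ‖x‖ = 1 := mem_sphere_zero_iff_norm.1 hx
    have : L x = x := by
      rw [hLe (show 1 ≤ ‖x‖ from hx1.ge), hKid x (by linarith)]
    simp [this, hx1]

/-- The image of the unit ball under an injective continuous map contains a neighbourhood of the
image of the centre. Otherwise a point `c` close to the image of the centre is missed, and the
inverse map can be perturbed near `c` to a map without zeros on the image of the ball, contradicting
`exists_zero_of_close_to_id`. -/
theorem image_closedBall_mem_nhds {f : E → E} (hc : ContinuousOn f (closedBall 0 1))
    (hf : InjOn f (closedBall 0 1)) : f '' closedBall 0 1 ∈ 𝓝 (f 0) := by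
  rcases subsingleton_or_nontrivial E with hE | hE
  · have : f '' closedBall 0 1 = univ :=
      eq_univ_of_forall fun y => ⟨0, by simp, Subsingleton.elim _ _⟩
    rw [this]; exact Filter.univ_mem
  set S := f '' closedBall 0 1 with hS
  have hScomp : IsCompact S := (isCompact_closedBall (0 : E) 1).image_of_continuousOn hc
  have h0S : (0 : E) ∈ closedBall (0 : E) 1 := by simp
  -- a continuous extension `G` of the inverse of `f`
  obtain ⟨G, hG⟩ : ∃ G : C(E, E), ∀ x ∈ closedBall (0 : E) 1, G (f x) = x := by
    have hleft : LeftInvOn (Function.invFunOn f (closedBall 0 1)) f (closedBall 0 1) :=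
      hf.leftInvOn_invFunOn
    obtain ⟨G, hG⟩ := ContinuousMap.exists_restrict_eq hScomp.isClosed
      ⟨_, (continuousOn_image_of_leftInvOn (isCompact_closedBall (0 : E) 1) hc
        hleft).domRestrict⟩
    exact ⟨G, fun x hx => (congrArg (fun F => F ⟨f x, mem_image_of_mem f hx⟩) hG).trans
      (hleft hx)⟩
  by_contra hmem
  obtain ⟨ε, hε, hGε⟩ : ∃ ε > 0, ∀ y, dist y (f 0) < 2 * ε → ‖G y‖ ≤ 1 / 20 := by
    have h1 : ∀ᶠ y in 𝓝 (f 0), ‖G y‖ < 1 / 20 := by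
      refine G.continuous.norm.continuousAt.eventually (gt_mem_nhds ?_)
      simp only [hG 0 h0S, norm_zero]; norm_num
    obtain ⟨ε, hε, h⟩ := Metric.eventually_nhds_iff.1 h1
    exact ⟨ε / 2, by positivity, fun y hy => (h (by linarith)).le⟩
  obtain ⟨c, hcε, hcS⟩ : ∃ c, dist c (f 0) < ε ∧ c ∉ S := by
    by_contra! h
    exact hmem (Filter.mem_of_superset (ball_mem_nhds (f 0) hε) fun y hy => h y hy)
  -- `G` is bounded below on the part of `S` away from `c`
  obtain ⟨δ, hδ, hδ1, hGδ⟩ : ∃ δ > 0, δ ≤ 1 / 20 ∧ ∀ y ∈ S, ε ≤ dist y c → δ ≤ ‖G y‖ := by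
    have hcomp : IsCompact (S ∩ {y | ε ≤ dist y c}) :=
      hScomp.inter_right (isClosed_le continuous_const (by fun_prop))
    have hpos : ∀ y ∈ S ∩ {y | ε ≤ dist y c}, 0 < ‖G y‖ := by
      rintro _ ⟨⟨x, hx, rfl⟩, hy⟩
      rw [hG x hx, norm_pos_iff]
      rintro rfl
      rw [mem_ofPred_eq, dist_comm] at hy
      linarith
    obtain ⟨δ, hδ, h⟩ := hcomp.exists_forall_le' G.continuous.norm.continuousOn hpos
    exact ⟨min δ (1 / 20), by positivity, min_le_right _ _,
      fun y hy h' => (min_le_left _ _).trans (h y ⟨hy, h'⟩)⟩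
  -- a smooth approximation of `G` without zeros on the sphere of radius `ε` around `c`
  obtain ⟨P, hPc, hPG, hP0⟩ : ∃ P : E → E, Continuous P ∧ (∀ y, ‖P y - G y‖ < δ) ∧
      ∀ y ∈ sphere c ε, P y ≠ 0 := by
    obtain ⟨Q, hQs, hQd, -⟩ := G.continuous.exists_contDiff_approx (n := 1) (ε := fun _ => δ / 2)
      continuous_const (fun _ => by positivity)
    have h1 : volume (Q '' sphere c ε) = 0 :=
      addHaar_image_eq_zero_of_differentiableOn_of_addHaar_eq_zero volume
        (hQs.differentiable one_ne_zero).differentiableOn (Measure.addHaar_sphere volume c ε)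
    obtain ⟨v, hv, hvQ⟩ : ∃ v ∈ ball (0 : E) (δ / 2), v ∉ Q '' sphere c ε := by
      by_contra! h
      exact (measure_ball_pos volume (0 : E) (half_pos hδ)).ne'
        (measure_mono_null (fun v hv => h v hv) h1)
    refine ⟨fun y => Q y - v, hQs.continuous.sub continuous_const, fun y => ?_, fun y hy h => ?_⟩
    · have h2 := hQd y
      rw [dist_eq_norm] at h2
      rw [mem_ball_zero_iff] at hv
      calc ‖Q y - v - G y‖ = ‖(Q y - G y) - v‖ := by congr 1; abel
        _ ≤ ‖Q y - G y‖ + ‖v‖ := norm_sub_le _ _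
        _ < δ := by linarith
    · exact hvQ ⟨y, hy, sub_eq_zero.1 h⟩
  -- push the points near `c` radially to that sphere
  set Φ : E → E := fun y => c + max (ε / ‖y - c‖) 1 • (y - c) with hΦ
  have hΦc : ContinuousOn Φ S := by
    intro y hy
    have hyc : ‖y - c‖ ≠ 0 := by
      rw [norm_ne_zero_iff, sub_ne_zero]; rintro rfl; exact hcS hy
    refine ContinuousAt.continuousWithinAt ?_
    have h1 : ContinuousAt (fun y => ‖y - c‖) y := by fun_prop
    exact continuousAt_const.add (((continuousAt_const.div h1 hyc).max continuousAt_const).smul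
      (continuousAt_id.sub continuousAt_const))
  have hΦ1 : ∀ y, ε ≤ dist y c → Φ y = y := by
    intro y hy
    rw [dist_eq_norm] at hy
    simp only [hΦ]
    rw [max_eq_right ((div_le_one (hε.trans_le hy)).2 hy), one_smul, add_sub_cancel]
  have hΦ2 : ∀ y ∈ S, dist y c < ε → Φ y ∈ sphere c ε := by
    intro y hy hyε
    have hyc : 0 < ‖y - c‖ := by
      rw [norm_pos_iff, sub_ne_zero]; rintro rfl; exact hcS hy
    rw [dist_eq_norm] at hyε
    simp only [hΦ]
    rw [max_eq_left ((one_le_div hyc).2 hyε.le), mem_sphere_iff_norm, add_sub_cancel_left,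
      norm_smul, norm_div, norm_norm, Real.norm_of_nonneg hε.le, div_mul_cancel₀ _ hyc.ne']
  obtain ⟨x, hx, hx0⟩ := exists_zero_of_close_to_id (H := fun x => P (Φ (f x)))
    (hPc.comp_continuousOn (hΦc.comp hc (mapsTo_image _ _))) (by
      intro x hx
      have hy : f x ∈ S := mem_image_of_mem f hx
      have hgx := hG x hx
      rcases le_or_gt ε (dist (f x) c) with h | h
      · rw [hΦ1 _ h]
        have := hPG (f x)
        rw [hgx] at this
        linarith
      · have h1 := hPG (Φ (f x))
        have h2 : ‖G (Φ (f x))‖ ≤ 1 / 20 := by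
          refine hGε _ ((dist_triangle _ c _).trans_lt ?_)
          rw [mem_sphere.1 (hΦ2 _ hy h)]
          linarith
        have h3 : ‖x‖ ≤ 1 / 20 := by
          rw [← hgx]
          exact hGε _ ((dist_triangle _ c _).trans_lt (by linarith))
        calc ‖P (Φ (f x)) - x‖ = ‖(P (Φ (f x)) - G (Φ (f x))) + G (Φ (f x)) - x‖ := by
              congr 1; abel
          _ ≤ ‖P (Φ (f x)) - G (Φ (f x))‖ + ‖G (Φ (f x))‖ + ‖x‖ :=
            (norm_sub_le _ _).trans (by gcongr; exact norm_add_le _ _)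
          _ ≤ 1 / 4 := by linarith)
  have hy : f x ∈ S := mem_image_of_mem f hx
  rcases le_or_gt ε (dist (f x) c) with h | h
  · have h1 := hPG (f x)
    have h2 := hGδ _ hy h
    simp only [hΦ1 _ h] at hx0
    rw [hx0, zero_sub, norm_neg] at h1
    linarith
  · exact hP0 _ (hΦ2 _ hy h) hx0

end innerProduct

/-- **Invariance of domain**: an injective continuous map from an open set of a finite-dimensional
space to a space of the same dimension has open image. -/
theorem isOpen_image_of_injOn {E F : Type*} [NormedAddCommGroup E] [NormedSpace ℝ E]
    [FiniteDimensional ℝ E] [NormedAddCommGroup F] [NormedSpace ℝ F] [FiniteDimensional ℝ F]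
    (hEF : Module.finrank ℝ E = Module.finrank ℝ F) {f : E → F} {U : Set E} (hU : IsOpen U)
    (hc : ContinuousOn f U) (hf : InjOn f U) : IsOpen (f '' U) := by
  let V := EuclideanSpace ℝ (Fin (Module.finrank ℝ E))
  let e : V ≃L[ℝ] E := ContinuousLinearEquiv.ofFinrankEq (by simp [V])
  let e' : F ≃L[ℝ] V := ContinuousLinearEquiv.ofFinrankEq (by simp [V, hEF])
  rw [isOpen_iff_mem_nhds]
  rintro _ ⟨x, hx, rfl⟩
  obtain ⟨ρ, hρ, hball⟩ : ∃ ρ : ℝ, 0 < ρ ∧ ∀ z ∈ closedBall (0 : V) 1, x + ρ • e z ∈ U := by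
    have h1 : ∀ᶠ ρ : ℝ in 𝓝 0, ∀ z ∈ closedBall (0 : V) 1, x + ρ • e z ∈ U := by
      refine (isCompact_closedBall (0 : V) 1).eventually_forall_of_forall_eventually fun z _ => ?_
      have h2 : Continuous fun q : ℝ × V => x + q.1 • e q.2 := by fun_prop
      exact h2.continuousAt.eventually (hU.mem_nhds (by simpa using hx))
    obtain ⟨ε, hε, h⟩ := Metric.eventually_nhds_iff.1 h1
    exact ⟨ε / 2, by positivity,
      h (by rw [Real.dist_0_eq_abs, abs_of_pos (by positivity)]; linarith)⟩
  have h1 := image_closedBall_mem_nhds (f := fun z : V => e' (f (x + ρ • e z)))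
    (e'.continuous.comp_continuousOn (hc.comp (by fun_prop) hball)) (by
      intro z hz w hw hzw
      have h2 := hf (hball z hz) (hball w hw) (e'.injective hzw)
      have h3 : ρ • e z = ρ • e w := add_left_cancel h2
      exact e.injective (smul_right_injective _ hρ.ne' h3))
  have h2 := e'.continuous.continuousAt.preimage_mem_nhds
    (x := f x) (t := (fun z : V => e' (f (x + ρ • e z))) '' closedBall 0 1) (by simpa using h1)
  refine Filter.mem_of_superset h2 ?_
  rintro y ⟨z, hz, hzy⟩
  rw [← e'.injective hzy]
  exact mem_image_of_mem f (hball z hz)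

end invarianceOfDomain

/-! ### Faces of codimension two in a regular complex -/

section regularComplex

open MeasureTheory Set Metric Topology

/-- Invariance of domain for maps from an open piece of a sphere to a space of the same
dimension. -/
lemma isOpen_image_of_injOn_sphere {E F : Type*} [NormedAddCommGroup E] [NormedSpace ℝ E]
    [FiniteDimensional ℝ E] [NormedAddCommGroup F] [NormedSpace ℝ F] [FiniteDimensional ℝ F]
    (hEF : Module.finrank ℝ E = Module.finrank ℝ F + 1) {f : E → F} {O : Set E} (hO : IsOpen O)
    (hc : ContinuousOn f (O ∩ sphere 0 1)) (hf : InjOn f (O ∩ sphere 0 1)) :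
    IsOpen (f '' (O ∩ sphere 0 1)) := by
  -- pass to the open cone over `O` and the map `t v ↦ (f v, t)`
  set U : Set E := {x | x ≠ 0} ∩ (fun x => ‖x‖⁻¹ • x) ⁻¹' O with hUdef
  have hdir : ContinuousOn (fun x : E => ‖x‖⁻¹ • x) {x | x ≠ 0} := fun x hx =>
    ((continuous_norm.continuousAt.inv₀ (norm_ne_zero_iff.2 hx)).smul
      continuousAt_id).continuousWithinAt
  have hU : IsOpen U := hdir.isOpen_inter_preimage isOpen_ne hO
  have hmaps : MapsTo (fun x : E => ‖x‖⁻¹ • x) U (O ∩ sphere 0 1) := by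
    rintro x ⟨hx, hxO⟩
    refine ⟨hxO, ?_⟩
    rw [mem_sphere_zero_iff_norm, norm_smul, norm_inv, norm_norm,
      inv_mul_cancel₀ (norm_ne_zero_iff.2 hx)]
  have h1 : IsOpen ((fun x : E => (f (‖x‖⁻¹ • x), ‖x‖)) '' U) := by
    refine isOpen_image_of_injOn (by simp [hEF]) hU ?_ ?_
    · exact (hc.comp (hdir.mono inter_subset_left) hmaps).prodMk continuous_norm.continuousOn
    · intro x hx y hy hxy
      obtain ⟨h1, h2⟩ := Prod.mk.inj hxy
      have h3 := hf (hmaps hx) (hmaps hy) h1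
      simp only at h3
      rw [h2] at h3
      exact smul_right_injective _ (inv_ne_zero (norm_ne_zero_iff.2 hy.1)) h3
  convert h1.preimage (Continuous.prodMk_left (1 : ℝ)) using 1
  ext w
  constructor
  · rintro ⟨x, ⟨hxO, hx⟩, rfl⟩
    rw [mem_sphere_zero_iff_norm] at hx
    refine ⟨x, ⟨?_, ?_⟩, ?_⟩
    · rw [mem_ofPred_eq, ← norm_ne_zero_iff, hx]; exact one_ne_zero
    · simpa [hx] using hxO
    · simp [hx]
  · rintro ⟨x, hx, h⟩
    exact ⟨_, hmaps hx, (Prod.mk.inj h).1⟩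

namespace CWCell

variable {X : Type u} [TopologicalSpace X] {C : Set X} [Topology.CWComplex C]

/-- The open cell. -/
def interior (x : CWCell C) : Set X := RelCWComplex.openCell x.dim x.idx

/-- The boundary of a cell. -/
def frontier (x : CWCell C) : Set X := RelCWComplex.cellFrontier x.dim x.idx

lemma frontier_union_interior (x : CWCell C) : x.frontier ∪ x.interior = x.closed :=
  RelCWComplex.cellFrontier_union_openCell_eq_closedCell _ _

lemma interior_nonempty (x : CWCell C) : x.interior.Nonempty := RelCWComplex.openCell_nonempty _ _

lemma interior_subset_closed (x : CWCell C) : x.interior ⊆ x.closed :=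
  RelCWComplex.openCell_subset_closedCell _ _

lemma frontier_subset_closed (x : CWCell C) : x.frontier ⊆ x.closed :=
  RelCWComplex.cellFrontier_subset_closedCell _ _

lemma eq_of_mem_interior {x y : CWCell C} {p : X} (hx : p ∈ x.interior) (hy : p ∈ y.interior) :
    x = y := by
  obtain ⟨n, i⟩ := x
  obtain ⟨m, j⟩ := y
  have h := RelCWComplex.eq_of_not_disjoint_openCell (n := n) (j := i) (m := m) (i := j)
    (Set.not_disjoint_iff.2 ⟨p, hx, hy⟩)
  cases h; rfl

lemma exists_finite_frontier_subset (x : CWCell C) : ∃ s : Set (CWCell C), s.Finite ∧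
    (∀ w ∈ s, w.dim < x.dim) ∧ ∀ p ∈ x.frontier, ∃ w ∈ s, p ∈ w.interior := by
  obtain ⟨I, hI⟩ := CWComplex.cellFrontier_subset_finite_openCell x.dim x.idx
  refine ⟨⋃ m ∈ Finset.range x.dim, (fun j => ⟨m, j⟩) '' (I m : Set _), ?_, ?_, ?_⟩
  · exact Set.Finite.biUnion (Finset.finite_toSet _) fun m _ => (Finset.finite_toSet _).image _
  · intro w hw
    simp only [mem_iUnion] at hw
    obtain ⟨m, hm, j, hj, rfl⟩ := hw
    exact Finset.mem_range.1 hm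
  · intro p hp
    have h := hI hp
    simp only [mem_iUnion] at h
    obtain ⟨m, hm, j, hj, h⟩ := h
    refine ⟨⟨m, j⟩, ?_, h⟩
    simp only [mem_iUnion]
    exact ⟨m, Finset.mem_range.2 hm, j, hj, rfl⟩

lemma eq_or_dim_lt_of_mem {x y : CWCell C} {p : X} (hx : p ∈ x.interior) (hy : p ∈ y.closed) :
    x = y ∨ x.dim < y.dim := by
  rw [← frontier_union_interior] at hy
  rcases hy with hy | hy
  · obtain ⟨s, -, hs, h⟩ := y.exists_finite_frontier_subset
    obtain ⟨w, hw, hpw⟩ := h p hy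
    rw [eq_of_mem_interior hx hpw]
    exact Or.inr (hs w hw)
  · exact Or.inl (eq_of_mem_interior hx hy)

lemma eq_or_dim_lt {x y : CWCell C} (h : x ≤ y) : x = y ∨ x.dim < y.dim := by
  obtain ⟨p, hp⟩ := x.interior_nonempty
  exact eq_or_dim_lt_of_mem hp (h (interior_subset_closed x hp))

lemma dim_lt_of_lt {x y : CWCell C} (h : x < y) : x.dim < y.dim :=
  (eq_or_dim_lt h.le).resolve_left fun he => by subst he; exact lt_irrefl _ h

lemma mem_frontier_of_mem {x y : CWCell C} {p : X} (hx : p ∈ x.interior) (hy : p ∈ y.closed)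
    (hxy : x ≠ y) : p ∈ y.frontier := by
  rw [← frontier_union_interior] at hy
  exact hy.resolve_right fun h => hxy (eq_of_mem_interior hx h)

lemma disjoint_frontier_interior {x : CWCell C} {p : X} (h : p ∈ x.frontier) :
    p ∉ x.interior := by
  intro h'
  obtain ⟨s, -, hs, hf⟩ := x.exists_finite_frontier_subset
  obtain ⟨w, hw, hpw⟩ := hf p h
  have := hs w hw
  rw [eq_of_mem_interior h' hpw] at this
  exact lt_irrefl _ this

/-- The characteristic map of a regular cell is injective on the whole closed ball. -/
lemma injOn_map (hC : IsRegularCW C) (x : CWCell C) :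
    InjOn (RelCWComplex.map (C := C) x.dim x.idx) (closedBall 0 1) := by
  have hs : InjOn (RelCWComplex.map (C := C) x.dim x.idx) (sphere 0 1) := fun a ha b hb h =>
    congrArg Subtype.val ((hC x.dim x.idx).injective (a₁ := ⟨a, ha⟩) (a₂ := ⟨b, hb⟩) h)
  have hb : InjOn (RelCWComplex.map (C := C) x.dim x.idx) (ball 0 1) := by
    rw [← RelCWComplex.source_eq (C := C) x.dim x.idx]
    exact (RelCWComplex.map (C := C) x.dim x.idx).injOn
  have hd : ∀ a ∈ sphere 0 1, ∀ b ∈ ball 0 1, RelCWComplex.map (C := C) x.dim x.idx a ≠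
      RelCWComplex.map (C := C) x.dim x.idx b := fun a ha b hb h =>
    disjoint_frontier_interior (x := x) ⟨a, ha, rfl⟩ ⟨b, hb, h.symm⟩
  rw [← ball_union_sphere]
  rintro a (ha | ha) b (hb' | hb') h
  · exact hb ha hb' h
  · exact absurd h.symm (hd b hb' a ha)
  · exact absurd h (hd a ha b hb')
  · exact hs ha hb' h

lemma injOn_chart {x : CWCell C} {g : X → (Fin x.dim → ℝ)}
    (hg : LeftInvOn g (RelCWComplex.map (C := C) x.dim x.idx) (closedBall 0 1)) :
    InjOn g x.closed := by
  rintro _ ⟨a, ha, rfl⟩ _ ⟨b, hb, rfl⟩ h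
  rw [hg ha, hg hb] at h
  rw [h]

/-- An injective continuous map from an open piece of the boundary sphere of a `(k+1)`-cell to a
`k`-dimensional space has open image. -/
lemma isOpen_image_frontier (hC : IsRegularCW C) (z : CWCell C) {F : Type*}
    [NormedAddCommGroup F] [NormedSpace ℝ F] [FiniteDimensional ℝ F]
    (hF : z.dim = Module.finrank ℝ F + 1)
    {W : Set X} (hW : IsOpen W) {g : X → F} (hg : ContinuousOn g (W ∩ z.frontier))
    (hi : InjOn g (W ∩ z.frontier)) :
    IsOpen (g '' (W ∩ z.frontier)) := by
  have hcs : ContinuousOn (RelCWComplex.map (C := C) z.dim z.idx) (sphere 0 1) :=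
    (RelCWComplex.continuousOn (C := C) z.dim z.idx).mono sphere_subset_closedBall
  obtain ⟨O, hO, hOW⟩ := continuousOn_iff'.1 hcs W hW
  have hmaps : MapsTo (RelCWComplex.map (C := C) z.dim z.idx) (O ∩ sphere 0 1)
      (W ∩ z.frontier) := by
    intro a ha
    exact ⟨(hOW.symm.subset ha).1, a, ha.2, rfl⟩
  have himg : RelCWComplex.map (C := C) z.dim z.idx '' (O ∩ sphere 0 1) = W ∩ z.frontier := by
    refine subset_antisymm hmaps.image_subset ?_
    rintro _ ⟨hp, a, ha, rfl⟩
    exact ⟨a, hOW.subset ⟨hp, ha⟩, rfl⟩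
  rw [← himg, ← image_comp]
  refine isOpen_image_of_injOn_sphere (by simpa using hF) hO ?_ ?_
  · exact hg.comp (hcs.mono inter_subset_right) hmaps
  · exact hi.comp ((injOn_map hC z).mono (inter_subset_right.trans sphere_subset_closedBall)) hmaps

variable [T2Space X]

lemma isClosed_closed (x : CWCell C) : IsClosed x.closed := RelCWComplex.isClosed_closedCell

lemma isClosed_frontier (x : CWCell C) : IsClosed x.frontier := RelCWComplex.isClosed_cellFrontier

lemma closed_subset_frontier {x y : CWCell C} (h : x.interior ⊆ y.frontier) :
    x.closed ⊆ y.frontier := by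
  rw [closed, ← RelCWComplex.closure_openCell_eq_closedCell]
  exact closure_minimal h y.isClosed_frontier

/-- A continuous inverse of the characteristic map of a regular cell. -/
lemma exists_chart (hC : IsRegularCW C) (x : CWCell C) :
    ∃ g : X → (Fin x.dim → ℝ), ContinuousOn g x.closed ∧
      LeftInvOn g (RelCWComplex.map (C := C) x.dim x.idx) (closedBall 0 1) :=
  ⟨_, continuousOn_image_of_leftInvOn (isCompact_closedBall _ _)
    (RelCWComplex.continuousOn (C := C) x.dim x.idx) (injOn_map hC x).leftInvOn_invFunOn,
    (injOn_map hC x).leftInvOn_invFunOn⟩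

/-- If an open piece of the boundary of a `(k+1)`-cell lies in a closed `k`-cell, then it lies in
its interior. -/
lemma subset_interior_of_subset_closed (hC : IsRegularCW C) {z e : CWCell C}
    (hd : z.dim = e.dim + 1) {W : Set X} (hW : IsOpen W) (h : W ∩ z.frontier ⊆ e.closed) :
    W ∩ z.frontier ⊆ e.interior := by
  obtain ⟨g, hgc, hg⟩ := exists_chart hC e
  have h1 : IsOpen (g '' (W ∩ z.frontier)) := isOpen_image_frontier hC z (by simpa using hd) hW
    (hgc.mono h) ((injOn_chart hg).mono h)
  have h2 : g '' (W ∩ z.frontier) ⊆ closedBall 0 1 := by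
    rintro _ ⟨p, hp, rfl⟩
    obtain ⟨a, ha, rfl⟩ := h hp
    rwa [hg ha]
  intro p hp
  obtain ⟨a, ha, hap⟩ := h hp
  refine ⟨a, ?_, hap⟩
  have h3 : a ∈ _root_.interior (closedBall (0 : Fin e.dim → ℝ) 1) := by
    refine interior_maximal h2 h1 ⟨p, hp, ?_⟩
    rw [← hap, hg ha]
  rwa [interior_closedBall _ one_ne_zero] at h3

/-- No open piece of the boundary of a `(k+1)`-cell lies in a closed cell of dimension `< k`. -/
lemma eq_empty_of_subset_closed (hC : IsRegularCW C) {z e : CWCell C}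
    (hd : e.dim + 1 < z.dim) {W : Set X} (hW : IsOpen W) (h : W ∩ z.frontier ⊆ e.closed) :
    W ∩ z.frontier = ∅ := by
  obtain ⟨g, hgc, hg⟩ := exists_chart hC e
  obtain ⟨k, hk⟩ : ∃ k, z.dim = k + 1 := ⟨z.dim - 1, by omega⟩
  obtain ⟨j, hj⟩ : ∃ j, k = e.dim + (j + 1) := ⟨k - e.dim - 1, by omega⟩
  let L : (Fin e.dim → ℝ) →ₗ[ℝ] (Fin e.dim → ℝ) × (Fin (j + 1) → ℝ) := LinearMap.inl ℝ _ _
  have hL : Function.Injective L := LinearMap.inl_injective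
  have h1 : IsOpen ((L ∘ g) '' (W ∩ z.frontier)) := by
    refine isOpen_image_frontier hC z (by simp [hk, hj]) hW ?_ ?_
    · exact L.continuous_of_finiteDimensional.comp_continuousOn (hgc.mono h)
    · exact hL.comp_injOn ((injOn_chart hg).mono h)
  by_contra hne
  rw [← ne_eq, ← nonempty_iff_ne_empty] at hne
  have h2 : LinearMap.range L = ⊤ := by
    refine Submodule.eq_top_of_nonempty_interior' _ ?_
    refine (hne.image (L ∘ g)).mono (interior_maximal ?_ h1)
    rintro _ ⟨p, -, rfl⟩
    exact ⟨g p, rfl⟩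
  obtain ⟨a, ha⟩ := LinearMap.range_eq_top.1 h2 (0, fun _ => 1)
  have h3 := congrFun (congrArg Prod.snd ha) 0
  simp [L] at h3

/-- The boundary of a `(k+1)`-cell is nowhere covered by finitely many cells of dimension `< k`. -/
lemma eq_empty_of_subset_biUnion (hC : IsRegularCW C) {z : CWCell C} {s : Set (CWCell C)}
    (hs : s.Finite) (hd : ∀ e ∈ s, e.dim + 1 < z.dim) {W : Set X} (hW : IsOpen W)
    (h : W ∩ z.frontier ⊆ ⋃ e ∈ s, e.closed) : W ∩ z.frontier = ∅ := by
  induction s, hs using Set.Finite.induction_on generalizing W with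
  | empty => simpa using h
  | @insert e s _ _ ih =>
    refine eq_empty_of_subset_closed hC (hd e (mem_insert _ _)) hW fun p hp => ?_
    by_contra hpe
    have h1 := ih (fun e he => hd e (mem_insert_of_mem _ he)) (W := W ∩ e.closedᶜ)
      (hW.inter e.isClosed_closed.isOpen_compl) (by
        rintro q ⟨⟨hq, hqe⟩, hqz⟩
        have := h ⟨hq, hqz⟩
        rw [biUnion_insert] at this
        exact this.resolve_left hqe)
    exact (h1.subset (⟨⟨hp.1, hpe⟩, hp.2⟩ : p ∈ (W ∩ e.closedᶜ) ∩ z.frontier)).elim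

/-- In a regular complex, a `k`-cell that meets the boundary of a `(k+1)`-cell is contained in
it. -/
lemma closed_subset_frontier_of_mem (hC : IsRegularCW C) {z e : CWCell C}
    (hd : z.dim = e.dim + 1) {p : X} (hp : p ∈ e.interior) (hz : p ∈ z.frontier) :
    e.closed ⊆ z.frontier := by
  obtain ⟨g, hgc, hg⟩ := exists_chart hC e
  obtain ⟨s, hs, hsd, hsz⟩ := z.exists_finite_frontier_subset
  set W : Set X := (⋃ w ∈ s \ {e}, w.closed)ᶜ with hWdef
  have hW : IsOpen W :=
    ((hs.subset sdiff_subset).isClosed_biUnion fun w _ => w.isClosed_closed).isOpen_compl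
  have hWe : W ∩ z.frontier = e.interior ∩ z.frontier := by
    ext q
    constructor
    · rintro ⟨hq, hqz⟩
      obtain ⟨w, hw, hqw⟩ := hsz q hqz
      by_cases hwe : w = e
      · exact ⟨hwe ▸ hqw, hqz⟩
      · exact absurd (mem_biUnion (show w ∈ s \ {e} from ⟨hw, hwe⟩)
          (interior_subset_closed w hqw)) hq
    · rintro ⟨hq, hqz⟩
      refine ⟨fun hq' => ?_, hqz⟩
      simp only [mem_iUnion] at hq'
      obtain ⟨w, ⟨hw, hwe⟩, hqw⟩ := hq'
      rcases eq_or_dim_lt_of_mem hq hqw with h | h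
      · exact hwe h.symm
      · have := hsd w hw
        omega
  have h1 : IsOpen (g '' (W ∩ z.frontier)) := by
    have h : W ∩ z.frontier ⊆ e.closed := hWe.subset.trans
      (inter_subset_left.trans e.interior_subset_closed)
    exact isOpen_image_frontier hC z (by simpa using hd) hW (hgc.mono h)
      ((injOn_chart hg).mono h)
  have h2 : g '' (W ∩ z.frontier) =
      ball 0 1 ∩ (closedBall 0 1 ∩ RelCWComplex.map (C := C) e.dim e.idx ⁻¹' z.frontier) := by
    rw [hWe]
    ext a
    constructor
    · rintro ⟨_, ⟨⟨b, hb, rfl⟩, hbz⟩, rfl⟩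
      rw [hg (ball_subset_closedBall hb)]
      exact ⟨hb, ball_subset_closedBall hb, hbz⟩
    · rintro ⟨ha, ha', haz⟩
      exact ⟨_, ⟨⟨a, ha, rfl⟩, haz⟩, hg ha'⟩
  have h3 : IsClosed (closedBall 0 1 ∩ RelCWComplex.map (C := C) e.dim e.idx ⁻¹' z.frontier) :=
    (RelCWComplex.continuousOn (C := C) e.dim e.idx).preimage_isClosed_of_isClosed
      isClosed_closedBall z.isClosed_frontier
  -- the part of the open cell `e` in the boundary of `z` is open and closed in it
  have h4 : ball 0 1 ⊆ g '' (W ∩ z.frontier) := by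
    refine IsPreconnected.subset_of_closure_inter_subset
      (convex_ball (0 : Fin e.dim → ℝ) 1).isPreconnected h1 ?_ ?_
    · obtain ⟨a, ha, rfl⟩ := hp
      refine ⟨a, ha, ?_⟩
      rw [h2]
      exact ⟨ha, ball_subset_closedBall ha, hz⟩
    · rintro a ⟨ha, hab⟩
      rw [h2] at ha ⊢
      exact ⟨hab, closure_minimal inter_subset_right h3 ha⟩
  refine closed_subset_frontier ?_
  rintro _ ⟨a, ha, rfl⟩
  have := h4 ha
  rw [h2] at this
  exact this.2.2

/-- In a regular complex, a face of codimension two of a cell lies in at least two of the faces of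
codimension one. -/
theorem exists_ne_between (hC : IsRegularCW C) {x y z : CWCell C} (hxy : x ≤ y) (hyz : y ≤ z)
    (hdy : y.dim = x.dim + 1) (hdz : z.dim = y.dim + 1) :
    ∃ y' : CWCell C, y' ≠ y ∧ y'.dim = y.dim ∧ x ≤ y' ∧ y' ≤ z := by
  by_contra! hun
  obtain ⟨p, hp⟩ := x.interior_nonempty
  have hpz : p ∈ z.frontier :=
    mem_frontier_of_mem hp (hyz (hxy (interior_subset_closed x hp))) (by rintro rfl; omega)
  obtain ⟨s, hs, hsd, hsz⟩ := z.exists_finite_frontier_subset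
  -- near `p`, the boundary of `z` is covered by `y` and cells of smaller dimension
  set W : Set X := (⋃ w ∈ {w ∈ s | p ∉ w.closed}, w.closed)ᶜ with hWdef
  have hW : IsOpen W :=
    ((hs.subset (sep_subset _ _)).isClosed_biUnion fun w _ => w.isClosed_closed).isOpen_compl
  have hpW : p ∈ W := by
    intro h
    simp only [mem_iUnion] at h
    obtain ⟨w, ⟨-, hw⟩, hw'⟩ := h
    exact hw hw'
  have hcov : W ∩ y.closedᶜ ∩ z.frontier ⊆ ⋃ w ∈ {w ∈ s | w.dim < y.dim}, w.closed := by
    rintro q ⟨⟨hqW, hqy⟩, hqz⟩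
    obtain ⟨w, hw, hqw⟩ := hsz q hqz
    have hqw' := interior_subset_closed w hqw
    refine mem_biUnion (show w ∈ {w ∈ s | w.dim < y.dim} from ⟨hw, ?_⟩) hqw'
    by_contra hlt
    have hdw : w.dim = y.dim := by have := hsd w hw; omega
    have hwy : w ≠ y := by rintro rfl; exact hqy hqw'
    by_cases hpw : p ∈ w.closed
    · have h1 : w ≤ z := (closed_subset_frontier_of_mem hC (by omega) hqw hqz).trans
        z.frontier_subset_closed
      have h2 : x ≤ w := (closed_subset_frontier_of_mem hC (by omega) hp
        (mem_frontier_of_mem hp hpw (by rintro rfl; omega))).trans w.frontier_subset_closed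
      exact hun w hwy hdw h2 h1
    · exact hqW (mem_biUnion (show w ∈ {w ∈ s | p ∉ w.closed} from ⟨hw, hpw⟩) hqw')
  have h1 := eq_empty_of_subset_biUnion hC (hs.subset (sep_subset _ _))
    (fun w hw => by have := hw.2; omega) (hW.inter y.isClosed_closed.isOpen_compl) hcov
  have h2 : W ∩ z.frontier ⊆ y.closed := by
    intro q hq
    by_contra hqy
    exact (h1.subset (⟨⟨hq.1, hqy⟩, hq.2⟩ : q ∈ W ∩ y.closedᶜ ∩ z.frontier)).elim
  have h3 := subset_interior_of_subset_closed hC hdz hW h2 ⟨hpW, hpz⟩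
  have := eq_of_mem_interior hp h3
  subst this
  omega

/-- No cell is at the same time the upper part of a regular pair and the lower part of another: if
`x < y < z` were such cells, then the value of a discrete Morse function at a second face `y'`
between `x` and `z` would contradict one of the two conditions in its definition. -/
theorem not_regularPair_regularPair (hC : IsRegularCW C) {φ : CWCell C → ℝ}
    (hφ : IsDiscreteMorse φ) {x y z : CWCell C} (hxy : RegularPair φ x y)
    (hyz : RegularPair φ y z) : False := by
  obtain ⟨y', hne, hd, h1, h2⟩ := exists_ne_between hC hxy.2.1 hyz.2.1 hxy.1 hyz.1
  have h3 : φ x < φ y' := by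
    by_contra! h
    exact hne (hφ.up x y' y (by rw [hd, hxy.1]) hxy.1 h1 hxy.2.1 h hxy.2.2)
  have h4 : φ z ≤ φ y' := hyz.2.2.trans (hxy.2.2.trans h3.le)
  exact hne (hφ.down z y' y (by rw [hyz.1, hd]) hyz.1 h2 hyz.2.1 h4 hyz.2.2)

end CWCell

end regularComplex

/-! ### Calculus in a localization -/

namespace Loc

variable {A : Type u} [Category.{v} A] {W : MorphismProperty A}

/-- The image of a morphism in the localization. -/
def of {a b : A} (f : a ⟶ b) : (⟨a⟩ : Loc W) ⟶ ⟨b⟩ := cls (WZigzag.single f)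

/-- The formal inverse of a morphism of `W`, or of an identity. -/
def inv {x y : A} (f : x ⟶ y) (hf : PlusId W f) : (⟨y⟩ : Loc W) ⟶ ⟨x⟩ :=
  cls (WZigzag.cons (𝟙 y) f hf (WZigzag.single (𝟙 x)))

lemma of_id (a : A) : of (W := W) (𝟙 a) = 𝟙 _ := rfl

lemma of_comp {a b c : A} (f : a ⟶ b) (g : b ⟶ c) : of (W := W) (f ≫ g) = of f ≫ of g := rfl

lemma cls_cons {w y x z : A} (g : w ⟶ y) (f : x ⟶ y) (hf : PlusId W f) (t : WZigzag W x z) :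
    cls (a := ⟨w⟩) (b := ⟨z⟩) (WZigzag.cons g f hf t) =
      of g ≫ inv f hf ≫ cls (a := ⟨x⟩) (b := ⟨z⟩) t := by
  change _ = cls (WZigzag.cons (g ≫ 𝟙 y) f hf (WZigzag.precomp (𝟙 x) t))
  rw [Category.comp_id, WZigzag.precomp_id]

lemma of_inv {x y : A} (f : x ⟶ y) (hf : PlusId W f) : of f ≫ inv f hf = 𝟙 (⟨x⟩ : Loc W) := by
  have h0 := cls_cons f f hf (WZigzag.single (𝟙 x))
  rw [show cls (a := ⟨x⟩) (b := ⟨x⟩) (WZigzag.single (𝟙 x)) = 𝟙 (⟨x⟩ : Loc W) from rfl,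
    Category.comp_id] at h0
  rw [← h0]
  have h1 : WZigzag.Rel (WZigzag.cons (𝟙 x) (𝟙 x) (PlusId.id x) (WZigzag.single (𝟙 x)))
      (WZigzag.cons f f hf (WZigzag.single (𝟙 x))) :=
    Or.inr (WZigzag.Ladder.cons _ f (𝟙 x) _ _ _ _ _ _ _ _ hf (PlusId.id x) rfl rfl
      (WZigzag.Ladder.single _ _ _ (Category.id_comp _)))
  have h2 := WZigzag.HRel.dropBackward (𝟙 x) (PlusId.id x) (WZigzag.single (W := W) (𝟙 x))
  rw [WZigzag.precomp_id] at h2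
  exact (Quot.sound h1).symm.trans (Quot.sound (Or.inl h2))

lemma inv_of {x y : A} (f : x ⟶ y) (hf : PlusId W f) : inv f hf ≫ of f = 𝟙 (⟨y⟩ : Loc W) := by
  have h1 : WZigzag.Rel (WZigzag.cons (𝟙 y) f hf (WZigzag.single f))
      (WZigzag.cons (𝟙 y) (𝟙 y) (PlusId.id y) (WZigzag.single (𝟙 y))) :=
    Or.inr (WZigzag.Ladder.cons _ (𝟙 y) f _ _ _ _ _ _ _ _ (PlusId.id y) hf rfl
      (by rw [Category.comp_id]) (WZigzag.Ladder.single _ _ _ (Category.comp_id _)))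
  have h2 := WZigzag.HRel.dropBackward (𝟙 y) (PlusId.id y) (WZigzag.single (W := W) (𝟙 y))
  rw [WZigzag.precomp_id] at h2
  have h3 : inv f hf ≫ of f = cls (a := ⟨y⟩) (b := ⟨y⟩)
      (WZigzag.cons (𝟙 y) f hf (WZigzag.single f)) := by
    change cls (WZigzag.cons (𝟙 y) f hf (WZigzag.single (𝟙 x ≫ f))) = _
    rw [Category.id_comp]
  rw [h3]
  exact (Quot.sound h1).trans (Quot.sound (Or.inl h2))

/-- The induction principle of the localization: morphisms are generated by the images of the
morphisms of `A` and the formal inverses. -/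
lemma induction {motive : ∀ {a b : A}, ((⟨a⟩ : Loc W) ⟶ ⟨b⟩) → Prop}
    (hof : ∀ {a b : A} (f : a ⟶ b), motive (of f))
    (hinv : ∀ {a b : A} (f : a ⟶ b) (hf : PlusId W f), motive (inv f hf))
    (hcomp : ∀ {a b c : A} (γ : (⟨a⟩ : Loc W) ⟶ ⟨b⟩) (δ : (⟨b⟩ : Loc W) ⟶ ⟨c⟩),
      motive γ → motive δ → motive (γ ≫ δ)) {a b : A} (γ : (⟨a⟩ : Loc W) ⟶ ⟨b⟩) : motive γ := by
  obtain ⟨t⟩ := γ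
  have key : ∀ {a b : A} (t : WZigzag W a b), motive (cls (a := ⟨a⟩) (b := ⟨b⟩) t) := by
    intro a b t
    induction t with
    | single g => exact hof g
    | cons g f hf t ih =>
      rw [cls_cons]
      exact hcomp _ _ (hof g) (hcomp _ _ (hinv f hf) ih)
  exact key t

section word

variable {M : Type*} [Monoid M] (w : ∀ {a b : A}, (a ⟶ b) → M)

/-- The product of the values of `w` on the forward arrows of a zigzag. -/
def zigWord {a b : A} : WZigzag W a b → M
  | .single g => w g
  | .cons g _ _ t => w g * zigWord t

lemma zigWord_precomp (hcomp : ∀ {a b c : A} (f : a ⟶ b) (g : b ⟶ c), w (f ≫ g) = w f * w g)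
    {a b c : A} (g : a ⟶ b) (t : WZigzag W b c) :
    zigWord w (t.precomp g) = w g * zigWord w t := by
  cases t <;> simp [WZigzag.precomp, zigWord, hcomp, mul_assoc]

lemma zigWord_comp (hcomp : ∀ {a b c : A} (f : a ⟶ b) (g : b ⟶ c), w (f ≫ g) = w f * w g)
    {a b c : A} (t : WZigzag W a b) (s : WZigzag W b c) :
    zigWord w (t.comp s) = zigWord w t * zigWord w s := by
  induction t with
  | single g => exact zigWord_precomp w hcomp g s
  | cons g f hf t ih => simp [WZigzag.comp, zigWord, ih, mul_assoc]

/-- A multiplicative function that is trivial on `W` is invariant under the relations between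
zigzags. -/
lemma zigWord_rel (hid : ∀ a : A, w (𝟙 a) = 1)
    (hcomp : ∀ {a b c : A} (f : a ⟶ b) (g : b ⟶ c), w (f ≫ g) = w f * w g)
    (hW : ∀ {a b : A} (f : a ⟶ b), W f → w f = 1) {a b : A} {t t' : WZigzag W a b}
    (h : WZigzag.Rel t t') : zigWord w t = zigWord w t' := by
  have hP : ∀ {a b : A} {f : a ⟶ b}, PlusId W f → w f = 1 := by
    intro a b f hf
    cases hf with
    | id => exact hid _
    | of _ hf => exact hW _ hf
  have key : ∀ {a a' b : A} {v : a ⟶ a'} {t : WZigzag W a b} {t' : WZigzag W a' b},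
      WZigzag.Ladder (fun f g => f = g) v t t' → w v * zigWord w t' = zigWord w t := by
    intro a a' b v t t' h
    induction h with
    | single v g g' hg => simp only [zigWord]; rw [← hg, hcomp]
    | cons v u v' g g' f f' hf hf' t t' hu hv' hg hff hl ih =>
      have h1 := congrArg (fun f => w f) hg
      simp only [hcomp, hP hu, mul_one] at h1
      rw [hP hv', one_mul] at ih
      simp only [zigWord]
      rw [← mul_assoc, h1, ih]
  rcases h with h | h
  · induction h with
    | dropBackward g hf t => rw [zigWord_precomp w hcomp]; rfl
    | dropForward => simp [zigWord, hid]
    | cons _ _ _ _ ih => simp [zigWord, ih]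
  · have := key h
    rwa [hid, one_mul, eq_comm] at this

end word

end Loc

/-! ### Normal forms in the localization at a Morse system -/

namespace CWCell

variable {X : Type u} [TopologicalSpace X] {C : Set X} [Topology.CWComplex C] {φ : CWCell C → ℝ}

/-- The object of the localization given by a cell. -/
abbrev toLoc (φ : CWCell C → ℝ) (x : CWCell C) : Loc (morseSystem φ) := ⟨⟨x⟩⟩

/-- The entrance path with a single step. -/
def edge {x y : CWCell C} (h : y < x) : (⟨x⟩ : Ent (CWCell C)) ⟶ ⟨y⟩ :=
  EntrancePath.mk [y] (List.isChain_pair.2 h) rfl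

lemma RegularPair.lt {x y : CWCell C} (h : RegularPair φ x y) : x < y := by
  refine lt_of_le_not_ge h.2.1 fun h' => ?_
  have h1 := h.1
  rcases eq_or_dim_lt h' with h2 | h2
  · rw [h2] at h1; omega
  · omega

lemma RegularPair.morseSystem {x y : CWCell C} (h : RegularPair φ x y) :
    morseSystem φ (edge h.lt) := ⟨rfl, h⟩

/-- The regular pairs are disjoint: no cell belongs to two of them. -/
structure IsMatching (φ : CWCell C → ℝ) : Prop where
  up : ∀ {x y y' : CWCell C}, RegularPair φ x y → RegularPair φ x y' → y = y'
  down : ∀ {x y y' : CWCell C}, RegularPair φ y x → RegularPair φ y' x → y = y'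
  not_both : ∀ {x y z : CWCell C}, RegularPair φ x y → RegularPair φ y z → False

/-- `Conn γ` says that `γ` is an identity, or the isomorphism between the two cells of a regular
pair, in either direction. -/
def Conn {a b : CWCell C} (γ : toLoc φ a ⟶ toLoc φ b) : Prop :=
  (∃ h : a = b, γ = eqToHom (congrArg (toLoc φ) h)) ∨
  (∃ h : RegularPair φ b a, γ = Loc.of (edge h.lt)) ∨
  (∃ h : RegularPair φ a b, γ = Loc.inv (edge h.lt) (PlusId.of _ h.morseSystem))

lemma RegularPair.irrefl {a : CWCell C} (h : RegularPair φ a a) : False := by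
  have := h.1; omega

lemma RegularPair.asymm {a b : CWCell C} (h : RegularPair φ a b) (h' : RegularPair φ b a) :
    False := by
  have := h.1; have := h'.1; omega

lemma Conn.refl (a : CWCell C) : Conn (𝟙 (toLoc φ a)) := Or.inl ⟨rfl, rfl⟩

lemma Conn.unique {a b : CWCell C} {γ γ' : toLoc φ a ⟶ toLoc φ b} (h : Conn γ) (h' : Conn γ') :
    γ = γ' := by
  rcases h with ⟨h, rfl⟩ | ⟨h, rfl⟩ | ⟨h, rfl⟩ <;>
  rcases h' with ⟨h', rfl⟩ | ⟨h', rfl⟩ | ⟨h', rfl⟩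
  · rfl
  · subst h; exact h'.irrefl.elim
  · subst h; exact h'.irrefl.elim
  · subst h'; exact h.irrefl.elim
  · rfl
  · exact (h.asymm h').elim
  · subst h'; exact h.irrefl.elim
  · exact (h.asymm h').elim
  · rfl

lemma Conn.comp (hM : IsMatching φ) {a b c : CWCell C} {γ : toLoc φ a ⟶ toLoc φ b}
    {γ' : toLoc φ b ⟶ toLoc φ c} (h : Conn γ) (h' : Conn γ') : Conn (γ ≫ γ') := by
  rcases h with ⟨rfl, rfl⟩ | ⟨h, rfl⟩ | ⟨h, rfl⟩
  · rw [eqToHom_refl, Category.id_comp]; exact h'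
  · rcases h' with ⟨rfl, rfl⟩ | ⟨h', rfl⟩ | ⟨h', rfl⟩
    · rw [eqToHom_refl, Category.comp_id]; exact Or.inr (Or.inl ⟨h, rfl⟩)
    · exact (hM.not_both h' h).elim
    · obtain rfl := hM.up h h'
      rw [Loc.of_inv]; exact Conn.refl _
  · rcases h' with ⟨rfl, rfl⟩ | ⟨h', rfl⟩ | ⟨h', rfl⟩
    · rw [eqToHom_refl, Category.comp_id]; exact Or.inr (Or.inr ⟨h, rfl⟩)
    · obtain rfl := hM.down h h'
      rw [Loc.inv_of]; exact Conn.refl _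
    · exact (hM.not_both h h').elim

lemma Conn.dim_le {a b : CWCell C} {γ : toLoc φ a ⟶ toLoc φ b} (h : Conn γ) :
    b.dim ≤ a.dim + 1 := by
  rcases h with ⟨rfl, -⟩ | ⟨h, -⟩ | ⟨h, -⟩
  · omega
  · have := h.1; omega
  · have := h.1; omega

lemma IsCritical.not_lower {a b : CWCell C} (ha : IsCritical φ a) : ¬ RegularPair φ a b :=
  fun h => ha.1 ⟨b, h⟩

lemma IsCritical.not_upper {a b : CWCell C} (ha : IsCritical φ a) : ¬ RegularPair φ b a :=
  fun h => ha.2 ⟨b, h⟩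

lemma Conn.eq_of_critical_left {a b : CWCell C} {γ : toLoc φ a ⟶ toLoc φ b} (h : Conn γ)
    (ha : IsCritical φ a) : a = b := by
  rcases h with ⟨h, -⟩ | ⟨h, -⟩ | ⟨h, -⟩
  · exact h
  · exact (ha.not_upper h).elim
  · exact (ha.not_lower h).elim

lemma Conn.eq_of_critical_right {a b : CWCell C} {γ : toLoc φ a ⟶ toLoc φ b} (h : Conn γ)
    (hb : IsCritical φ b) : a = b := by
  rcases h with ⟨h, -⟩ | ⟨h, -⟩ | ⟨h, -⟩
  · exact h
  · exact (hb.not_lower h).elim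
  · exact (hb.not_upper h).elim

/-- `Nf l γ` says that `γ` is the composite of the steps in the list `l`, none of them a regular
pair, with isomorphisms coming from regular pairs inserted where necessary. -/
inductive Nf (φ : CWCell C → ℝ) : List (CWCell C × CWCell C) → ∀ {a b : CWCell C},
    (toLoc φ a ⟶ toLoc φ b) → Prop
  | nil {a b : CWCell C} {γ : toLoc φ a ⟶ toLoc φ b} (h : Conn γ) : Nf φ [] γ
  | cons {a x z b : CWCell C} {τ : toLoc φ a ⟶ toLoc φ x} (h : z < x) (hn : ¬ RegularPair φ z x)
      {l : List (CWCell C × CWCell C)} {γ : toLoc φ z ⟶ toLoc φ b} (hτ : Conn τ) (hγ : Nf φ l γ) :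
      Nf φ ((x, z) :: l) (τ ≫ Loc.of (edge h) ≫ γ)

namespace Nf

lemma unique {l : List (CWCell C × CWCell C)} {a b : CWCell C} {γ γ' : toLoc φ a ⟶ toLoc φ b}
    (h : Nf φ l γ) (h' : Nf φ l γ') : γ = γ' := by
  induction h with
  | nil h => cases h' with | nil h' => exact h.unique h'
  | cons h hn hτ hγ ih =>
    cases h' with
    | cons h' hn' hτ' hγ' => rw [hτ.unique hτ', ih hγ']

lemma comp (hM : IsMatching φ) {l l' : List (CWCell C × CWCell C)} {a b c : CWCell C}
    {γ : toLoc φ a ⟶ toLoc φ b} {γ' : toLoc φ b ⟶ toLoc φ c} (h : Nf φ l γ) (h' : Nf φ l' γ') :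
    Nf φ (l ++ l') (γ ≫ γ') := by
  induction h with
  | nil h =>
    cases h' with
    | nil h' => exact nil (h.comp hM h')
    | cons h' hn' hτ' hγ' =>
      rw [← Category.assoc]
      exact cons h' hn' (h.comp hM hτ') hγ'
  | cons h hn hτ hγ ih =>
    rw [Category.assoc, Category.assoc]
    exact cons h hn hτ (ih h')

/-- A morphism can be split at each step of its normal form. -/
lemma split {l m : List (CWCell C × CWCell C)} {x z a b : CWCell C}
    {γ : toLoc φ a ⟶ toLoc φ b} (h : Nf φ (l ++ (x, z) :: m) γ) :
    ∃ (hzx : z < x) (α : toLoc φ a ⟶ toLoc φ x) (β : toLoc φ z ⟶ toLoc φ b),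
      Nf φ l α ∧ Nf φ m β ∧ γ = α ≫ Loc.of (edge hzx) ≫ β := by
  induction l generalizing a with
  | nil =>
    cases h with
    | cons h hn hτ hγ => exact ⟨h, _, _, nil hτ, hγ, rfl⟩
  | cons e l ih =>
    cases h with
    | cons h hn hτ hγ =>
      obtain ⟨hzx, α, β, hα, hβ, rfl⟩ := ih hγ
      exact ⟨hzx, _, β, cons h hn hτ hα, hβ, by simp only [Category.assoc]⟩

/-- Normal forms are compatible with factorizations through critical cells. -/
lemma split_critical {l m : List (CWCell C × CWCell C)} {a b c : CWCell C}
    (hc : IsCritical φ c) {γ : toLoc φ a ⟶ toLoc φ b} (h : Nf φ (l ++ m) γ)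
    {u : toLoc φ a ⟶ toLoc φ c} (hu : Nf φ l u) : ∃ w : toLoc φ c ⟶ toLoc φ b, Nf φ m w := by
  rcases List.eq_nil_or_concat l with rfl | ⟨l, ⟨x, z⟩, rfl⟩
  · cases hu with
    | nil hu =>
      obtain rfl := hu.eq_of_critical_right hc
      exact ⟨γ, h⟩
  · rw [List.concat_eq_append] at h hu
    obtain ⟨-, -, β, -, hβ, -⟩ := hu.split
    cases hβ with
    | nil hβ =>
      obtain rfl := hβ.eq_of_critical_right hc
      rw [List.append_assoc] at h
      obtain ⟨-, -, w, -, hw, -⟩ := h.split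
      exact ⟨w, hw⟩

lemma dim_le {l : List (CWCell C × CWCell C)} {a b : CWCell C} {γ : toLoc φ a ⟶ toLoc φ b}
    (h : Nf φ l γ) (hb : IsCritical φ b) : b.dim ≤ a.dim := by
  induction h with
  | nil h => rw [h.eq_of_critical_right hb]
  | cons h hn hτ hγ ih =>
    have h1 := ih hb
    have h2 := dim_lt_of_lt h
    have h3 := hτ.dim_le
    omega

/-- Between critical cells, nontrivial morphisms lower the dimension: a step lowers it, and a
regular pair recovers at most one dimension. -/
lemma dim_lt {l : List (CWCell C × CWCell C)} {a b : CWCell C} {γ : toLoc φ a ⟶ toLoc φ b}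
    (h : Nf φ l γ) (ha : IsCritical φ a) (hb : IsCritical φ b) (hl : l ≠ []) : b.dim < a.dim := by
  cases h with
  | nil h => exact absurd rfl hl
  | cons h hn hτ hγ =>
    obtain rfl := hτ.eq_of_critical_left ha
    exact (hγ.dim_le hb).trans_lt (dim_lt_of_lt h)

lemma exists_edge {x z : CWCell C} (h : z < x) :
    ∃ l, Nf φ l (Loc.of (CWCell.edge h)) := by
  by_cases hr : RegularPair φ z x
  · exact ⟨[], nil (Or.inr (Or.inl ⟨hr, rfl⟩))⟩
  · have h1 := cons (τ := 𝟙 (toLoc φ x)) h hr (Conn.refl x) (nil (Conn.refl z))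
    rw [Category.id_comp, Category.comp_id] at h1
    exact ⟨_, h1⟩

end Nf

lemma path_cons {x y d : CWCell C} {l : List (CWCell C)} (f : EntrancePath x y)
    (h : f.tail = d :: l) : ∃ (hd : d < x) (f' : EntrancePath d y), f'.tail = l ∧
      (f : (⟨x⟩ : Ent (CWCell C)) ⟶ ⟨y⟩) = edge hd ≫ (f' : (⟨d⟩ : Ent (CWCell C)) ⟶ ⟨y⟩) := by
  obtain ⟨t, hc, hl⟩ := f
  subst h
  exact ⟨(List.isChain_cons_cons.1 hc).1, ⟨l, (List.isChain_cons_cons.1 hc).2, hl⟩, rfl, rfl⟩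

lemma path_nil {x y : CWCell C} (f : EntrancePath x y) (h : f.tail = []) :
    ∃ he : x = y, (f : (⟨x⟩ : Ent (CWCell C)) ⟶ ⟨y⟩) = eqToHom (congrArg Ent.mk he) := by
  obtain ⟨t, hc, hl⟩ := f
  subst h
  subst hl
  exact ⟨rfl, rfl⟩

/-- Every morphism of the localization has a normal form. -/
lemma exists_nf (hM : IsMatching φ) {a b : CWCell C} (γ : toLoc φ a ⟶ toLoc φ b) :
    ∃ l, Nf φ l γ := by
  have hof : ∀ {a b : Ent (CWCell C)} (f : a ⟶ b),
      ∃ l, Nf φ l (a := a.cell) (b := b.cell) (Loc.of f) := by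
    rintro ⟨a⟩ ⟨b⟩ f
    induction ht : EntrancePath.tail f generalizing a with
    | nil =>
      obtain ⟨he, h⟩ := path_nil f ht
      change a = b at he
      subst he
      rw [h]
      exact ⟨[], Nf.nil (Conn.refl _)⟩
    | cons d l ih =>
      obtain ⟨hd, f', hf', h⟩ := path_cons f ht
      rw [h, Loc.of_comp]
      obtain ⟨l1, h1⟩ := Nf.exists_edge hd
      obtain ⟨l2, h2⟩ := ih d f' hf'
      exact ⟨_, h1.comp hM h2⟩
  refine Loc.induction
    (motive := fun {a b} γ => ∃ l, Nf φ l (a := a.cell) (b := b.cell) γ) ?_ ?_ ?_ γ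
  · exact hof
  · rintro ⟨x⟩ ⟨y⟩ f hf
    refine ⟨[], Nf.nil ?_⟩
    cases hf with
    | id =>
      have h := Loc.of_inv (W := morseSystem φ) (𝟙 (⟨x⟩ : Ent (CWCell C))) (PlusId.id _)
      rw [Loc.of_id, Category.id_comp] at h
      rw [h]; exact Conn.refl x
    | of _ hf =>
      obtain ⟨h1, h2⟩ := hf
      have h3 : f = edge h2.lt := EntrancePath.ext (List.cons_injective h1)
      subst h3
      exact Or.inr (Or.inr ⟨h2, rfl⟩)
  · rintro a b c γ δ ⟨l, h⟩ ⟨m, h'⟩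
    exact ⟨_, h.comp hM h'⟩

open Classical in
/-- The steps of a descending sequence that are not regular pairs. -/
noncomputable def steps (φ : CWCell C → ℝ) :
    CWCell C → List (CWCell C) → FreeMonoid (CWCell C × CWCell C)
  | _, [] => 1
  | x, y :: l => (if RegularPair φ y x then 1 else FreeMonoid.of (x, y)) * steps φ y l

lemma steps_append (x y : CWCell C) (l l' : List (CWCell C))
    (h : (x :: l).getLast (List.cons_ne_nil x l) = y) :
    steps φ x (l ++ l') = steps φ x l * steps φ y l' := by
  induction l generalizing x with
  | nil =>
    simp only [List.getLast_singleton] at h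
    subst h
    simp [steps]
  | cons d l ih =>
    rw [List.getLast_cons (List.cons_ne_nil d l)] at h
    simp [steps, ih d h, mul_assoc]

/-- The word of a morphism of the localization: its steps that are not regular pairs. -/
noncomputable def word {a b : CWCell C} (γ : toLoc φ a ⟶ toLoc φ b) :
    FreeMonoid (CWCell C × CWCell C) :=
  Quot.lift (Loc.zigWord fun {a _} f => steps φ a.cell (EntrancePath.tail f))
    (fun _ _ h => by
      refine Loc.zigWord_rel (fun {a b} f => steps φ a.cell (EntrancePath.tail f)) ?_ ?_ ?_ h
      · intro a; rfl
      · intro a b c f g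
        exact steps_append _ _ _ _ (EntrancePath.last f)
      · intro a b f hf
        have h1 : EntrancePath.tail f = [b.cell] := List.cons_injective hf.1
        simp [h1, steps, hf.2]) γ

lemma word_comp {a b c : CWCell C} (γ : toLoc φ a ⟶ toLoc φ b) (δ : toLoc φ b ⟶ toLoc φ c) :
    word (γ ≫ δ) = word γ * word δ := by
  obtain ⟨t⟩ := γ
  obtain ⟨s⟩ := δ
  exact Loc.zigWord_comp _ (fun f g => steps_append _ _ _ _ (EntrancePath.last f)) t s

lemma Conn.word {a b : CWCell C} {γ : toLoc φ a ⟶ toLoc φ b} (h : Conn γ) : word γ = 1 := by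
  rcases h with ⟨rfl, rfl⟩ | ⟨h, rfl⟩ | ⟨h, rfl⟩
  · rfl
  · change steps φ a [b] = 1
    simp [steps, h]
  · change steps φ b [] * steps φ a [] = 1
    simp [steps]

lemma Nf.word_eq {l : List (CWCell C × CWCell C)} {a b : CWCell C} {γ : toLoc φ a ⟶ toLoc φ b}
    (h : Nf φ l γ) : word γ = FreeMonoid.ofList l := by
  induction h with
  | nil h => exact h.word
  | @cons a x z b τ h hn l γ hτ hγ ih =>
    have h1 : word (φ := φ) (Loc.of (CWCell.edge h)) = FreeMonoid.of (x, z) := by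
      change steps φ x [z] = _
      simp [steps, hn]
    rw [word_comp, word_comp, hτ.word, ih, h1]
    rfl

/-- The list of steps of a normal form is determined by the morphism. -/
lemma Nf.list_eq {l l' : List (CWCell C × CWCell C)} {a b : CWCell C}
    {γ : toLoc φ a ⟶ toLoc φ b} (h : Nf φ l γ) (h' : Nf φ l' γ) : l = l' :=
  FreeMonoid.ofList.injective (h.word_eq.symm.trans h'.word_eq)

/-- Two factorizations of a morphism through critical cells are comparable. -/
lemma exists_comparison (hM : IsMatching φ) {a b c c' : CWCell C} (hc : IsCritical φ c)
    (hc' : IsCritical φ c') {u : toLoc φ a ⟶ toLoc φ c} {v : toLoc φ c ⟶ toLoc φ b}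
    {u' : toLoc φ a ⟶ toLoc φ c'} {v' : toLoc φ c' ⟶ toLoc φ b} (h : u ≫ v = u' ≫ v') :
    (∃ w : toLoc φ c ⟶ toLoc φ c', u ≫ w = u' ∧ w ≫ v' = v) ∨
      (∃ w : toLoc φ c' ⟶ toLoc φ c, u' ≫ w = u ∧ w ≫ v = v') := by
  obtain ⟨lu, hu⟩ := exists_nf hM u
  obtain ⟨lv, hv⟩ := exists_nf hM v
  obtain ⟨lu', hu'⟩ := exists_nf hM u'
  obtain ⟨lv', hv'⟩ := exists_nf hM v'
  have h1 := hu.comp hM hv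
  rw [h] at h1
  rcases List.append_eq_append_iff.1 (h1.list_eq (hu'.comp hM hv')) with
    ⟨m, rfl, rfl⟩ | ⟨m, rfl, rfl⟩
  · obtain ⟨w, hw⟩ := hu'.split_critical hc hu
    exact Or.inl ⟨w, (hu.comp hM hw).unique hu', (hw.comp hM hv').unique hv⟩
  · obtain ⟨w, hw⟩ := hu.split_critical hc' hu'
    exact Or.inr ⟨w, (hu'.comp hM hw).unique hu, (hw.comp hM hv).unique hv'⟩

/-- Morphisms between critical cells are identities or lower the dimension. -/
lemma dim_lt_or_eq (hM : IsMatching φ) {a b : CWCell C} (ha : IsCritical φ a)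
    (hb : IsCritical φ b) (γ : toLoc φ a ⟶ toLoc φ b) :
    b.dim < a.dim ∨ ∃ h : a = b, γ = eqToHom (congrArg (toLoc φ) h) := by
  obtain ⟨l, hl⟩ := exists_nf hM γ
  by_cases h : l = []
  · subst h
    cases hl with
    | nil h =>
      obtain rfl := h.eq_of_critical_left ha
      exact Or.inr ⟨rfl, h.unique (Conn.refl _)⟩
  · exact Or.inl (hl.dim_lt ha hb h)

/-- The order of the localization is generated by inserting one cell into one step:
`Insert γ γ'` says that `γ'` arises from `γ` in this way. -/
def Insert {a b : CWCell C} (γ γ' : toLoc φ a ⟶ toLoc φ b) : Prop :=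
  ∃ (x y z : CWCell C) (h1 : y < x) (h2 : z < y) (α : toLoc φ a ⟶ toLoc φ x)
    (β : toLoc φ z ⟶ toLoc φ b), γ = α ≫ Loc.of (edge (h2.trans h1)) ≫ β ∧
      γ' = α ≫ Loc.of (edge h1) ≫ Loc.of (edge h2) ≫ β

lemma Insert.le {a b : CWCell C} {γ γ' : toLoc φ a ⟶ toLoc φ b} (h : Insert γ γ') : γ ≤ γ' := by
  obtain ⟨x, y, z, h1, h2, α, β, rfl, rfl⟩ := h
  have h3 : (Loc.of (edge (h2.trans h1)) : toLoc φ x ⟶ toLoc φ z) ≤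
      Loc.of (edge h1) ≫ Loc.of (edge h2) := by
    refine Relation.ReflTransGen.single ⟨WZigzag.single (edge h1 ≫ edge h2),
      WZigzag.single (edge (h2.trans h1)), rfl, rfl, WZigzag.Ladder.single _ _ _ ?_⟩
    rw [Category.id_comp]
    change List.Sublist [x, z] [x, y, z]
    exact List.Sublist.cons_cons _ (List.Sublist.cons _ (List.Sublist.refl _))
  have h4 := PCategory.comp_le_comp (le_refl α) (PCategory.comp_le_comp h3 (le_refl β))
  simpa only [Category.assoc] using h4

lemma Insert.comp_left {a b c : CWCell C} (δ : toLoc φ c ⟶ toLoc φ a)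
    {γ γ' : toLoc φ a ⟶ toLoc φ b} (h : Insert γ γ') : Insert (δ ≫ γ) (δ ≫ γ') := by
  obtain ⟨x, y, z, h1, h2, α, β, rfl, rfl⟩ := h
  exact ⟨x, y, z, h1, h2, δ ≫ α, β, by simp only [Category.assoc], by simp only [Category.assoc]⟩

lemma Insert.comp_right {a b c : CWCell C} {γ γ' : toLoc φ a ⟶ toLoc φ b} (h : Insert γ γ')
    (δ : toLoc φ b ⟶ toLoc φ c) : Insert (γ ≫ δ) (γ' ≫ δ) := by
  obtain ⟨x, y, z, h1, h2, α, β, rfl, rfl⟩ := h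
  exact ⟨x, y, z, h1, h2, α, β ≫ δ, by simp only [Category.assoc], by simp only [Category.assoc]⟩

/-- The reflexive and transitive closure of `Insert`. -/
def Inserts {a b : CWCell C} (γ γ' : toLoc φ a ⟶ toLoc φ b) : Prop :=
  Relation.ReflTransGen Insert γ γ'

lemma Inserts.le {a b : CWCell C} {γ γ' : toLoc φ a ⟶ toLoc φ b} (h : Inserts γ γ') : γ ≤ γ' := by
  induction h with
  | refl => exact le_rfl
  | tail _ h ih => exact ih.trans h.le

lemma Inserts.comp_left {a b c : CWCell C} (δ : toLoc φ c ⟶ toLoc φ a)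
    {γ γ' : toLoc φ a ⟶ toLoc φ b} (h : Inserts γ γ') : Inserts (δ ≫ γ) (δ ≫ γ') :=
  Relation.ReflTransGen.lift (δ ≫ ·) (fun _ _ h => Insert.comp_left δ h) _ _ h

lemma Inserts.comp_right {a b c : CWCell C} {γ γ' : toLoc φ a ⟶ toLoc φ b} (h : Inserts γ γ')
    (δ : toLoc φ b ⟶ toLoc φ c) : Inserts (γ ≫ δ) (γ' ≫ δ) :=
  Relation.ReflTransGen.lift (· ≫ δ) (fun _ _ h => Insert.comp_right h δ) _ _ h

lemma inserts_of_le {a b : Ent (CWCell C)} {f g : a ⟶ b} (h : f ≤ g) :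
    Inserts (φ := φ) (a := a.cell) (b := b.cell) (Loc.of f) (Loc.of g) := by
  obtain ⟨a⟩ := a
  obtain ⟨b⟩ := b
  replace h : (EntrancePath.tail f).Sublist (EntrancePath.tail g) := List.cons_sublist_cons.1 h
  induction hg : EntrancePath.tail g generalizing a with
  | nil =>
    rw [hg, List.sublist_nil] at h
    rw [show f = g from EntrancePath.ext (h.trans hg.symm)]
    exact Relation.ReflTransGen.refl
  | cons d l ih =>
    obtain ⟨hd, g', hg', hgg⟩ := path_cons g hg
    rw [hg] at h
    rw [hgg, Loc.of_comp]
    cases hf : EntrancePath.tail f with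
    | nil =>
      -- then `a = b`, and the nontrivial sequence `g` cannot exist
      have he : a = b := (path_nil f hf).1
      subst he
      have h1 : List.Pairwise (fun a b => b < a) (a :: EntrancePath.tail g) :=
        (EntrancePath.chain g).pairwise
      have h2 : a ∈ EntrancePath.tail g := by
        have h3 := EntrancePath.last g
        simp only [hg, List.getLast_cons (List.cons_ne_nil d l)] at h3
        rw [hg, ← h3]
        exact List.getLast_mem _
      exact (lt_irrefl _ ((List.pairwise_cons.1 h1).1 a h2)).elim
    | cons e l' =>
      obtain ⟨he, f', hf', hff⟩ := path_cons f hf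
      rw [hf] at h
      rw [hff, Loc.of_comp]
      rcases List.cons_sublist_cons'.1 h with h1 | ⟨rfl, h1⟩
      · have hed : e < d := by
          have h2 : List.Pairwise (fun a b => b < a) (d :: g'.tail) := g'.chain.pairwise
          refine (List.pairwise_cons.1 h2).1 e ?_
          rw [hg']
          exact h1.subset List.mem_cons_self
        have h3 := ih d (f := edge hed ≫ f') (g := g') (by
          change (e :: f'.tail).Sublist g'.tail
          rw [hf', hg']; exact h1) hg'
        refine Relation.ReflTransGen.head ?_ (h3.comp_left (Loc.of (edge hd)))
        rw [Loc.of_comp]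
        refine ⟨a, d, e, hd, hed, 𝟙 _, Loc.of f', ?_, ?_⟩
        · rw [Category.id_comp]
        · rw [Category.id_comp]
      · exact (ih e (f := f') (g := g') (by
          rw [hf', hg']; exact h1) hg').comp_left _

lemma inserts_of_ladder {a a' b : Ent (CWCell C)} {v : a ⟶ a'}
    {t : WZigzag (morseSystem φ) a b} {t' : WZigzag (morseSystem φ) a' b}
    (h : WZigzag.Ladder (fun f g => f ≤ g) v t t') :
    Inserts (φ := φ) (a := a.cell) (b := b.cell)
      (Loc.of v ≫ Loc.cls (a := ⟨a'⟩) (b := ⟨b⟩) t') (Loc.cls t) := by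
  induction h with
  | single v g g' hg => exact inserts_of_le hg
  | cons v u v' g g' f f' hf hf' t t' hu hv' hg hff hl ih =>
    rw [Loc.cls_cons, Loc.cls_cons]
    -- the square of the maps in the Morse system commutes, as both composites have the same length
    have hsq : v' ≫ f' = f ≫ u := by
      refine (morseLength φ).eq_of_len hff ?_
      rw [(morseLength φ).len_comp, (morseLength φ).len_comp, (morseLength φ).len_plus hf,
        (morseLength φ).len_plus hf', (morseLength φ).len_plus hu, (morseLength φ).len_plus hv']
      ring
    have h1 : Loc.of u ≫ Loc.inv f' hf' = Loc.inv f hf ≫ Loc.of v' := by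
      have h2 := congrArg (fun k => Loc.inv f hf ≫ Loc.of k ≫ Loc.inv f' hf') hsq
      simp only [Loc.of_comp, Category.assoc, Loc.of_inv, Category.comp_id] at h2
      rw [h2, ← Category.assoc, Loc.inv_of, Category.id_comp]
    have h3 := (inserts_of_le (φ := φ) hg).comp_right (Loc.inv f' hf' ≫ Loc.cls t')
    rw [Loc.of_comp, Loc.of_comp, Category.assoc, Category.assoc, ← Category.assoc (Loc.of u), h1,
      Category.assoc] at h3
    exact Relation.ReflTransGen.trans h3 ((ih.comp_left _).comp_left _)

lemma inserts_of_morphism_le {a b : CWCell C} {γ γ' : toLoc φ a ⟶ toLoc φ b} (h : γ ≤ γ') :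
    Inserts γ γ' := by
  change Loc.LE γ γ' at h
  induction h with
  | refl => exact Relation.ReflTransGen.refl
  | tail _ h ih =>
    obtain ⟨t, t', rfl, rfl, h⟩ := h
    have h1 := inserts_of_ladder h
    rw [Loc.of_id, Category.id_comp] at h1
    exact Relation.ReflTransGen.trans ih h1

lemma Insert.exists_lift (hM : IsMatching φ) {a b c : CWCell C} {γ' : toLoc φ a ⟶ toLoc φ b}
    {u : toLoc φ a ⟶ toLoc φ c} {v : toLoc φ c ⟶ toLoc φ b} (h : Insert (u ≫ v) γ') :
    ∃ (u' : toLoc φ a ⟶ toLoc φ c) (v' : toLoc φ c ⟶ toLoc φ b),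
      γ' = u' ≫ v' ∧ u ≤ u' ∧ v ≤ v' := by
  obtain ⟨x, y, z, h1, h2, α, β, huv, rfl⟩ := h
  obtain ⟨lu, hu⟩ := exists_nf hM u
  obtain ⟨lv, hv⟩ := exists_nf hM v
  obtain ⟨lα, hα⟩ := exists_nf hM α
  obtain ⟨lβ, hβ⟩ := exists_nf hM β
  have hn : ¬ RegularPair φ z x := by
    intro h
    have := h.1
    have := dim_lt_of_lt h1
    have := dim_lt_of_lt h2
    omega
  have hγ := hα.comp hM (Nf.cons (h2.trans h1) hn (Conn.refl x) hβ)
  rw [Category.id_comp, ← huv] at hγ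
  have hcase : (∃ m, lu = lα ++ (x, z) :: m ∧ lβ = m ++ lv) ∨
      (∃ m, lα = lu ++ m ∧ lv = m ++ (x, z) :: lβ) := by
    rcases List.append_eq_append_iff.1 (hγ.list_eq (hu.comp hM hv)) with ⟨m, h3, h4⟩ | ⟨m, h3, h4⟩
    · cases m with
      | nil => exact Or.inr ⟨[], by simpa using h3.symm, by simpa using h4.symm⟩
      | cons e m =>
        rw [List.cons_append, List.cons.injEq] at h4
        obtain ⟨rfl, h4⟩ := h4
        exact Or.inl ⟨m, h3, h4⟩
    · exact Or.inr ⟨m, h3, h4⟩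
  rcases hcase with ⟨m, rfl, rfl⟩ | ⟨m, rfl, rfl⟩
  · obtain ⟨-, α', β', hα', hβ', rfl⟩ := hu.split
    obtain rfl := hα'.unique hα
    obtain rfl := hβ.unique (hβ'.comp hM hv)
    exact ⟨_, v, by simp only [Category.assoc], Insert.le ⟨x, y, z, h1, h2, α', β', rfl, rfl⟩,
      le_rfl⟩
  · obtain ⟨-, α', β', hα', hβ', rfl⟩ := hv.split
    obtain rfl := hβ'.unique hβ
    obtain rfl := hα.unique (hu.comp hM hα')
    exact ⟨u, _, by simp only [Category.assoc], le_rfl,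
      Insert.le ⟨x, y, z, h1, h2, α', β', rfl, rfl⟩⟩

/-- Factorizations can be lifted along the order of the localization. -/
lemma exists_lift (hM : IsMatching φ) {a b c : CWCell C} {γ' : toLoc φ a ⟶ toLoc φ b}
    {u : toLoc φ a ⟶ toLoc φ c} {v : toLoc φ c ⟶ toLoc φ b} (h : u ≫ v ≤ γ') :
    ∃ (u' : toLoc φ a ⟶ toLoc φ c) (v' : toLoc φ c ⟶ toLoc φ b),
      γ' = u' ≫ v' ∧ u ≤ u' ∧ v ≤ v' := by
  induction inserts_of_morphism_le h with
  | refl => exact ⟨u, v, rfl, le_rfl, le_rfl⟩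
  | tail h1 h2 ih =>
    obtain ⟨u1, v1, rfl, hu, hv⟩ := ih (Inserts.le h1)
    obtain ⟨u2, v2, rfl, hu', hv'⟩ := h2.exists_lift hM
    exact ⟨u2, v2, rfl, hu.trans hu', hv.trans hv'⟩

end CWCell

/-! ### Categories with unique factorization into indecomposable morphisms -/

section directLevi

variable {𝒞 : Type u} [Category.{v} 𝒞]

/-- A criterion for a category to be free on a graph: nonidentity morphisms lower the degree of
objects, and two factorizations of the same morphism are comparable. -/
structure IsDirectLevi (𝒞 : Type u) [Category.{v} 𝒞] (deg : 𝒞 → ℕ) : Prop where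
  deg_lt : ∀ {a b : 𝒞} (f : a ⟶ b), deg b < deg a ∨ ∃ h : a = b, f = eqToHom h
  levi : ∀ {a b c c' : 𝒞} (u : a ⟶ c) (v : c ⟶ b) (u' : a ⟶ c') (v' : c' ⟶ b), u ≫ v = u' ≫ v' →
    (∃ w : c ⟶ c', u ≫ w = u' ∧ w ≫ v' = v) ∨ (∃ w : c' ⟶ c, u' ≫ w = u ∧ w ≫ v = v')

namespace IsDirectLevi

/-- A pair of composable morphisms with target `b`. -/
structure Factor (b : 𝒞) where
  {src : 𝒞}
  {mid : 𝒞}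
  fst : src ⟶ mid
  snd : mid ⟶ b

/-- Compose the second morphism of a pair with a further morphism. -/
def Factor.comp {b b' : 𝒞} (g : b ⟶ b') (p : Factor b) : Factor b' := ⟨p.fst, p.snd ≫ g⟩

/-- Indecomposable morphisms. Being an identity is expressed as having equal source and target,
since all endomorphisms are identities where this is used. -/
def Atom {a b : 𝒞} (f : a ⟶ b) : Prop :=
  a ≠ b ∧ ∀ (c : 𝒞) (u : a ⟶ c) (v : c ⟶ b), u ≫ v = f → a = c ∨ c = b

/-- `Fac m L`: if `m` is the composite of the indecomposable morphisms `α₁, …, αₖ`, then `L` is the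
list of the pairs `(αᵢ, αᵢ₊₁ ⋯ αₖ)`. -/
inductive Fac : ∀ {a b : 𝒞}, (a ⟶ b) → List (Factor b) → Prop
  | nil (b : 𝒞) : Fac (𝟙 b) []
  | cons {c d b : 𝒞} (α : c ⟶ d) (hα : Atom α) (r : d ⟶ b) {L : List (Factor b)} :
      Fac r L → Fac (α ≫ r) (⟨α, r⟩ :: L)

lemma Fac.comp {a b b' : 𝒞} {m : a ⟶ b} {L : List (Factor b)} (h : Fac m L) {m' : b ⟶ b'}
    {L' : List (Factor b')} (h' : Fac m' L') :
    Fac (m ≫ m') (L.map (Factor.comp m') ++ L') := by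
  induction h with
  | nil => rw [Category.id_comp]; exact h'
  | cons α hα r _ ih =>
    rw [Category.assoc]
    exact Fac.cons α hα _ (ih h')

variable {deg : 𝒞 → ℕ}

lemma eq_id (H : IsDirectLevi 𝒞 deg) {a : 𝒞} (f : a ⟶ a) : f = 𝟙 a := by
  rcases H.deg_lt f with h | ⟨_, h⟩
  · exact absurd h (lt_irrefl _)
  · exact h

lemma exists_fac (H : IsDirectLevi 𝒞 deg) {a b : 𝒞} (m : a ⟶ b) : ∃ L, Fac m L := by
  induction hn : deg a - deg b using Nat.strong_induction_on generalizing a b with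
  | _ n ih =>
    by_cases hab : a = b
    · subst hab
      rw [H.eq_id m]
      exact ⟨_, Fac.nil a⟩
    · by_cases hm : Atom m
      · have h := Fac.cons m hm (𝟙 b) (Fac.nil b)
        rw [Category.comp_id] at h
        exact ⟨_, h⟩
      · simp only [Atom, not_and, not_forall, not_or] at hm
        obtain ⟨c, x, y, rfl, hac, hcb⟩ := hm hab
        have h1 := (H.deg_lt x).resolve_right fun h => hac h.1
        have h2 := (H.deg_lt y).resolve_right fun h => hcb h.1
        obtain ⟨L1, hL1⟩ := ih _ (by omega) x rfl
        obtain ⟨L2, hL2⟩ := ih _ (by omega) y rfl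
        exact ⟨_, hL1.comp hL2⟩

lemma atom_unique (H : IsDirectLevi 𝒞 deg) {a b d d' : 𝒞} {α : a ⟶ d} {r : d ⟶ b} {α' : a ⟶ d'}
    {r' : d' ⟶ b}
    (hα : Atom α) (hα' : Atom α') (h : α ≫ r = α' ≫ r') :
    (⟨d, α, r⟩ : Σ d : 𝒞, (a ⟶ d) × (d ⟶ b)) = ⟨d', α', r'⟩ := by
  rcases H.levi α r α' r' h with ⟨w, hw, hw'⟩ | ⟨w, hw, hw'⟩
  · obtain rfl := (hα'.2 _ α w hw).resolve_left hα.1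
    rw [H.eq_id w, Category.comp_id] at hw
    rw [H.eq_id w, Category.id_comp] at hw'
    rw [hw, hw']
  · obtain rfl := (hα.2 _ α' w hw).resolve_left hα'.1
    rw [H.eq_id w, Category.comp_id] at hw
    rw [H.eq_id w, Category.id_comp] at hw'
    rw [hw, hw']

lemma fac_unique (H : IsDirectLevi 𝒞 deg) {a b : 𝒞} {m m' : a ⟶ b} {L L' : List (Factor b)}
    (h : Fac m L)
    (h' : Fac m' L') (hm : m = m') : L = L' := by
  have hne : ∀ {c d b : 𝒞} {α : c ⟶ d}, Atom α → (d ⟶ b) → c ≠ b := by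
    rintro c d b α hα r rfl
    have h1 := (H.deg_lt α).resolve_right fun h => hα.1 h.1
    rcases H.deg_lt r with h2 | ⟨h2, -⟩
    · omega
    · exact hα.1 h2.symm
  induction h with
  | nil b =>
    cases h' with
    | nil => rfl
    | cons α hα r _ => exact (hne hα r rfl).elim
  | cons α hα r hr ih =>
    cases h' with
    | nil => exact (hne hα r rfl).elim
    | cons α' hα' r' hr' =>
      have := H.atom_unique hα hα' hm
      cases this
      rw [ih hr' rfl]

/-- The list of the pairs `(αᵢ, αᵢ₊₁ ⋯ αₖ)` for a morphism with indecomposable factors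
`α₁, …, αₖ`. It is additive like a Fox derivative, see `factors_comp`. -/
noncomputable def factors (H : IsDirectLevi 𝒞 deg) {a b : 𝒞} (m : a ⟶ b) : List (Factor b) :=
  (H.exists_fac m).choose

lemma factors_fac (H : IsDirectLevi 𝒞 deg) {a b : 𝒞} (m : a ⟶ b) : Fac m (H.factors m) :=
  (H.exists_fac m).choose_spec

lemma factors_comp (H : IsDirectLevi 𝒞 deg) {a b c : 𝒞} (m : a ⟶ b) (m' : b ⟶ c) :
    H.factors (m ≫ m') = (H.factors m).map (Factor.comp m') ++ H.factors m' :=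
  H.fac_unique (H.factors_fac _) ((H.factors_fac m).comp (H.factors_fac m')) rfl

end IsDirectLevi

/-! ### Homology of the nerve -/

/-- The faces of a simplex of the nerve. -/
abbrev face {n : ℕ} (i : Fin (n + 2)) (τ : ComposableArrows 𝒞 (n + 1)) : ComposableArrows 𝒞 n :=
  (nerve 𝒞).δ i τ

lemma face_face_zero {n : ℕ} (i : Fin (n + 2)) (σ : ComposableArrows 𝒞 (n + 2)) :
    face 0 (face i.succ σ) = face i (face 0 σ) :=
  congrArg (fun k => k σ) (SimplicialObject.δ_comp_δ (nerve 𝒞) (Fin.zero_le i))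

lemma face_one_precomp {n : ℕ} {a b : 𝒞} (τ : ComposableArrows 𝒞 n) (g : b ⟶ τ.left) (f : a ⟶ b) :
    face 1 ((τ.precomp g).precomp f) = τ.precomp (f ≫ g) := by
  refine ComposableArrows.ext_succ rfl rfl ?_
  exact ((Category.id_comp _).trans (Category.comp_id _)).symm

lemma face_two_precomp {n : ℕ} {a b c : 𝒞} (τ : ComposableArrows 𝒞 n) (h : c ⟶ τ.left) (g : b ⟶ c)
    (f : a ⟶ b) : face (1 : Fin (n + 3)).succ (((τ.precomp h).precomp g).precomp f) =
      (τ.precomp (g ≫ h)).precomp f := by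
  refine ComposableArrows.ext_succ rfl
    ((face_face_zero 1 (((τ.precomp h).precomp g).precomp f)).trans (face_one_precomp τ h g)) ?_
  exact ((Category.id_comp _).trans (Category.comp_id _)).symm

lemma face_succ_succ_precomp {n : ℕ} {a : 𝒞} (τ : ComposableArrows 𝒞 (n + 1)) (f : a ⟶ τ.left)
    (i : Fin (n + 1)) :
    face i.succ.succ (τ.precomp f) = ComposableArrows.precomp (face i.succ τ) f := by
  refine ComposableArrows.ext_succ rfl (face_face_zero i.succ (τ.precomp f)) ?_
  exact ((Category.id_comp _).trans (Category.comp_id _)).symm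

lemma face_succ_succ_succ_precomp {n : ℕ} {a b : 𝒞} (τ : ComposableArrows 𝒞 (n + 1))
    (g : b ⟶ τ.left) (f : a ⟶ b) (i : Fin (n + 1)) :
    face i.succ.succ.succ ((τ.precomp g).precomp f) =
      (ComposableArrows.precomp (face i.succ τ) g).precomp f := by
  refine ComposableArrows.ext_succ rfl
    ((face_face_zero i.succ.succ ((τ.precomp g).precomp f)).trans
      (face_succ_succ_precomp τ g i)) ?_
  exact ((Category.id_comp _).trans (Category.comp_id _)).symm

/-- The alternating sum of the faces, on the free abelian group on the simplices of the nerve. -/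
noncomputable def nerveBoundary (𝒞 : Type u) [Category.{v} 𝒞] (n : ℕ) :
    FreeAbelianGroup (ComposableArrows 𝒞 (n + 1)) →+ FreeAbelianGroup (ComposableArrows 𝒞 n) :=
  ∑ i : Fin (n + 2), (-1 : ℤ) ^ (i : ℕ) • FreeAbelianGroup.map (face i)

lemma nerveBoundary_of {n : ℕ} (σ : ComposableArrows 𝒞 (n + 1)) :
    nerveBoundary 𝒞 n (FreeAbelianGroup.of σ) =
      ∑ i : Fin (n + 2), (-1 : ℤ) ^ (i : ℕ) • FreeAbelianGroup.of (face i σ) := by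
  simp [nerveBoundary]

/-- The simplex whose first two morphisms are `m` and `k`. -/
def cons₂ {n : ℕ} (τ : ComposableArrows 𝒞 n) {a b : 𝒞} (k : b ⟶ τ.left) (m : a ⟶ b) :
    ComposableArrows 𝒞 (n + 2) := (τ.precomp k).precomp m

/-- The simplex whose first three morphisms are `f`, `g` and `k`. -/
def cons₃ {n : ℕ} (τ : ComposableArrows 𝒞 n) {a b c : 𝒞} (k : c ⟶ τ.left) (f : a ⟶ b)
    (g : b ⟶ c) : ComposableArrows 𝒞 (n + 3) := ((τ.precomp k).precomp g).precomp f

/-- The faces of `cons₂ τ k m` that do not touch `m`. -/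
def consFace₂ {n : ℕ} (τ : ComposableArrows 𝒞 n) {a b : 𝒞} (k : b ⟶ τ.left) (i : Fin (n + 1))
    (m : a ⟶ b) : ComposableArrows 𝒞 (n + 1) :=
  ComposableArrows.precomp (face i.succ (τ.precomp k)) m

/-- The faces of `cons₃ τ k f g` that do not touch `f` and `g`. -/
def consFace₃ {n : ℕ} (τ : ComposableArrows 𝒞 n) {a b c : 𝒞} (k : c ⟶ τ.left) (i : Fin (n + 1))
    (f : a ⟶ b) (g : b ⟶ c) : ComposableArrows 𝒞 (n + 2) :=
  (ComposableArrows.precomp (face i.succ (τ.precomp k)) g).precomp f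

lemma nerveBoundary_cons₂ {n : ℕ} {a b : 𝒞} (τ : ComposableArrows 𝒞 n) (k : b ⟶ τ.left)
    (m : a ⟶ b) : nerveBoundary 𝒞 (n + 1) (FreeAbelianGroup.of (cons₂ τ k m)) =
      FreeAbelianGroup.of (τ.precomp k) - FreeAbelianGroup.of (τ.precomp (m ≫ k)) +
        ∑ i : Fin (n + 1), (-1 : ℤ) ^ (i : ℕ) • FreeAbelianGroup.of (consFace₂ τ k i m) := by
  rw [nerveBoundary_of, Fin.sum_univ_succ, Fin.sum_univ_succ]
  have h0 : face 0 (cons₂ τ k m) = τ.precomp k := rfl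
  have h1 : face (Fin.succ 0) (cons₂ τ k m) = τ.precomp (m ≫ k) := face_one_precomp τ k m
  have h2 : ∀ i : Fin (n + 1), face i.succ.succ (cons₂ τ k m) = consFace₂ τ k i m :=
    face_succ_succ_precomp (τ.precomp k) m
  simp only [h0, h1, h2, Fin.val_zero, Fin.val_succ, pow_zero,
    pow_succ, one_smul, mul_neg, mul_one, neg_smul, neg_neg]
  abel

lemma nerveBoundary_cons₃ {n : ℕ} {a b c : 𝒞} (τ : ComposableArrows 𝒞 n) (k : c ⟶ τ.left)
    (f : a ⟶ b) (g : b ⟶ c) :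
    nerveBoundary 𝒞 (n + 2) (FreeAbelianGroup.of (cons₃ τ k f g)) =
      FreeAbelianGroup.of (cons₂ τ k g) - FreeAbelianGroup.of (cons₂ τ k (f ≫ g)) +
        FreeAbelianGroup.of (cons₂ τ (g ≫ k) f) -
        ∑ i : Fin (n + 1), (-1 : ℤ) ^ (i : ℕ) • FreeAbelianGroup.of (consFace₃ τ k i f g) := by
  rw [nerveBoundary_of, Fin.sum_univ_succ, Fin.sum_univ_succ, Fin.sum_univ_succ]
  have h0 : face 0 (cons₃ τ k f g) = cons₂ τ k g := rfl
  have h1 : face (Fin.succ 0) (cons₃ τ k f g) = cons₂ τ k (f ≫ g) :=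
    face_one_precomp (τ.precomp k) g f
  have h2 : face (Fin.succ (Fin.succ 0)) (cons₃ τ k f g) = cons₂ τ (g ≫ k) f :=
    face_two_precomp τ k g f
  have h3 : ∀ i : Fin (n + 1), face i.succ.succ.succ (cons₃ τ k f g) = consFace₃ τ k i f g :=
    face_succ_succ_succ_precomp (τ.precomp k) g f
  simp only [h0, h1, h2, h3, Fin.val_zero, Fin.val_succ, pow_zero,
    pow_succ, one_smul, mul_neg, mul_one, neg_smul, neg_neg, Finset.sum_neg_distrib]
  abel

namespace IsDirectLevi

/-- The sum of the simplices attached by `ψ` to the pairs in a list. -/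
def sumFactors {b : 𝒞} {T : Type*} (ψ : ∀ {c d : 𝒞}, (c ⟶ d) → (d ⟶ b) → T)
    (L : List (Factor b)) : FreeAbelianGroup T :=
  (L.map fun p => FreeAbelianGroup.of (ψ p.fst p.snd)).sum

lemma sumFactors_nil {b : 𝒞} {T : Type*} (ψ : ∀ {c d : 𝒞}, (c ⟶ d) → (d ⟶ b) → T) :
    sumFactors ψ [] = 0 := rfl

lemma sumFactors_cons {b : 𝒞} {T : Type*} (ψ : ∀ {c d : 𝒞}, (c ⟶ d) → (d ⟶ b) → T)
    (p : Factor b) (L : List (Factor b)) :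
    sumFactors ψ (p :: L) = FreeAbelianGroup.of (ψ p.fst p.snd) + sumFactors ψ L := by
  simp [sumFactors]

lemma nerveBoundary_sumFactors {n : ℕ} (τ : ComposableArrows 𝒞 n) {b : 𝒞} (k : b ⟶ τ.left)
    {a : 𝒞} {m : a ⟶ b} {L : List (Factor b)} (h : Fac m L) :
    nerveBoundary 𝒞 (n + 2) (sumFactors (cons₃ τ k) L) =
      FreeAbelianGroup.of (cons₂ τ k (𝟙 b)) - FreeAbelianGroup.of (cons₂ τ k m) +
        sumFactors (fun f g => cons₂ τ (g ≫ k) f) L -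
        ∑ i : Fin (n + 1), (-1 : ℤ) ^ (i : ℕ) • sumFactors (consFace₃ τ k i) L := by
  induction h with
  | nil => simp [sumFactors_nil]
  | cons α hα r hr ih =>
    simp only [sumFactors_cons, smul_add, Finset.sum_add_distrib, map_add, ih k,
      nerveBoundary_cons₃]
    abel

variable {deg : 𝒞 → ℕ}

/-- The contracting homotopy on a simplex whose first morphism is `m` and whose remaining
morphisms are `τ`. -/
noncomputable def homotopySimplex (H : IsDirectLevi 𝒞 deg) {n : ℕ} (τ : ComposableArrows 𝒞 n)
    {a : 𝒞} (m : a ⟶ τ.left) :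
    FreeAbelianGroup (ComposableArrows 𝒞 (n + 2)) :=
  FreeAbelianGroup.of (cons₂ τ (𝟙 τ.left) (𝟙 τ.left)) -
    sumFactors (fun f g => cons₂ τ g f) (H.factors m)

/-- The contracting homotopy of the chains of the nerve in degrees at least two. -/
noncomputable def homotopy (H : IsDirectLevi 𝒞 deg) (n : ℕ) :
    FreeAbelianGroup (ComposableArrows 𝒞 (n + 1)) →+
      FreeAbelianGroup (ComposableArrows 𝒞 (n + 2)) :=
  FreeAbelianGroup.lift fun σ => H.homotopySimplex (face 0 σ) (σ.map' 0 1)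

lemma homotopy_precomp (H : IsDirectLevi 𝒞 deg) {n : ℕ} (τ : ComposableArrows 𝒞 n) {a : 𝒞}
    (m : a ⟶ τ.left) :
    H.homotopy n (FreeAbelianGroup.of (τ.precomp m)) =
      FreeAbelianGroup.of (cons₂ τ (𝟙 τ.left) (𝟙 τ.left)) -
        sumFactors (fun f g => cons₂ τ g f) (H.factors m) :=
  FreeAbelianGroup.lift_apply_of _ _

lemma homotopy_cons₂ (H : IsDirectLevi 𝒞 deg) {n : ℕ} (τ : ComposableArrows 𝒞 n) {a b : 𝒞}
    (k : b ⟶ τ.left) (m : a ⟶ b) :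
    H.homotopy (n + 1) (FreeAbelianGroup.of (cons₂ τ k m)) =
      FreeAbelianGroup.of (cons₃ τ k (𝟙 b) (𝟙 b)) - sumFactors (cons₃ τ k) (H.factors m) :=
  FreeAbelianGroup.lift_apply_of _ _

lemma homotopy_consFace₂ (H : IsDirectLevi 𝒞 deg) {n : ℕ} (τ : ComposableArrows 𝒞 n) {a b : 𝒞}
    (k : b ⟶ τ.left)
    (i : Fin (n + 1)) (m : a ⟶ b) :
    H.homotopy n (FreeAbelianGroup.of (consFace₂ τ k i m)) =
      FreeAbelianGroup.of (consFace₃ τ k i (𝟙 b) (𝟙 b)) -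
        sumFactors (consFace₃ τ k i) (H.factors m) :=
  FreeAbelianGroup.lift_apply_of _ _

lemma sumFactors_factors_comp (H : IsDirectLevi 𝒞 deg) {a b c : 𝒞} {T : Type*}
    (ψ : ∀ {x y : 𝒞}, (x ⟶ y) → (y ⟶ c) → T)
    (m : a ⟶ b) (k : b ⟶ c) : sumFactors ψ (H.factors (m ≫ k)) =
      sumFactors (fun f g => ψ f (g ≫ k)) (H.factors m) + sumFactors ψ (H.factors k) := by
  rw [H.factors_comp, sumFactors, List.map_append, List.sum_append, List.map_map]
  rfl

/-- Fox calculus: the telescoping sum over the indecomposable factors of the first morphism `m` of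
a simplex reduces it to the simplex with `m` replaced by an identity, and such simplices cancel in
pairs. -/
lemma nerveBoundary_homotopy_cons₂ (H : IsDirectLevi 𝒞 deg) {n : ℕ} (τ : ComposableArrows 𝒞 n)
    {a b : 𝒞}
    (k : b ⟶ τ.left) (m : a ⟶ b) :
    nerveBoundary 𝒞 (n + 2) (H.homotopy (n + 1) (FreeAbelianGroup.of (cons₂ τ k m))) +
      H.homotopy n (nerveBoundary 𝒞 (n + 1) (FreeAbelianGroup.of (cons₂ τ k m))) =
        FreeAbelianGroup.of (cons₂ τ k m) := by
  simp only [homotopy_cons₂, nerveBoundary_cons₂, map_sub, map_add, map_sum, map_zsmul,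
    nerveBoundary_cons₃, homotopy_consFace₂, homotopy_precomp,
    nerveBoundary_sumFactors τ k (H.factors_fac m), sumFactors_factors_comp, smul_sub,
    Finset.sum_sub_distrib, Category.id_comp]
  abel

lemma nerveBoundary_homotopy (H : IsDirectLevi 𝒞 deg) {n : ℕ}
    (x : FreeAbelianGroup (ComposableArrows 𝒞 (n + 2))) :
    nerveBoundary 𝒞 (n + 2) (H.homotopy (n + 1) x) + H.homotopy n (nerveBoundary 𝒞 (n + 1) x) =
      x := by
  induction x using FreeAbelianGroup.induction_on with
  | zero => simp
  | neg x hx =>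
    simp only [map_neg]
    rw [← neg_add, hx]
  | add x y hx hy =>
    simp only [map_add]
    rw [add_add_add_comm, hx, hy]
  | of σ =>
    obtain ⟨τ, a, m, rfl⟩ := σ.precomp_surjective
    obtain ⟨τ, b, k, rfl⟩ := τ.precomp_surjective
    exact H.nerveBoundary_homotopy_cons₂ τ k m

theorem exists_nerveBoundary_eq (H : IsDirectLevi 𝒞 deg) {n : ℕ}
    (x : FreeAbelianGroup (ComposableArrows 𝒞 (n + 2)))
    (hx : nerveBoundary 𝒞 (n + 1) x = 0) : ∃ y, nerveBoundary 𝒞 (n + 2) y = x :=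
  ⟨H.homotopy (n + 1) x, by
    have h := H.nerveBoundary_homotopy x
    rwa [hx, map_zero, add_zero] at h⟩

end IsDirectLevi

end directLevi

/-! ### Unique factorization in the discrete flow category -/

namespace IsDirectLevi

variable {A : Type u} [PCategory.{v} A] {deg : A → ℕ}

/-- The `i`-th entry of a morphism of the level-`n` category. -/
def entryHom {n : ℕ} {a b : NLevel A n} (f : a ⟶ b) (i : Fin (n + 1)) : a.obj ⟶ b.obj :=
  (show Fin (n + 1) →o (a.obj ⟶ b.obj) from f) i

lemma entryHom_ext {n : ℕ} {a b : NLevel A n} {f g : a ⟶ b}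
    (h : ∀ i, entryHom f i = entryHom g i) : f = g :=
  OrderHom.ext _ _ (funext h)

lemma entryHom_mono {n : ℕ} {a b : NLevel A n} (f : a ⟶ b) : Monotone (entryHom f) :=
  OrderHom.monotone _

/-- Two factorizations of a morphism through the same object agree. -/
lemma factorization_unique (H : IsDirectLevi A deg) {a b c : A} {u u' : a ⟶ c} {v v' : c ⟶ b}
    (h : u ≫ v = u' ≫ v') : u = u' ∧ v = v' := by
  rcases H.levi u v u' v' h with ⟨w, h1, h2⟩ | ⟨w, h1, h2⟩
  · rw [H.eq_id w, Category.comp_id] at h1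
    rw [H.eq_id w, Category.id_comp] at h2
    exact ⟨h1, h2.symm⟩
  · rw [H.eq_id w, Category.comp_id] at h1
    rw [H.eq_id w, Category.id_comp] at h2
    exact ⟨h1.symm, h2⟩

/-- The connecting morphisms between two factorizations of a chain form a chain: lifting the `i`-th
factorization along the order to the `j`-th composite gives the `j`-th factorization, which is
unique. -/
lemma exists_nLevel_comparison (H : IsDirectLevi A deg)
    (hlift : ∀ {a b c : A} {u : a ⟶ c} {v : c ⟶ b} {γ : a ⟶ b}, u ≫ v ≤ γ →
      ∃ (u' : a ⟶ c) (v' : c ⟶ b), γ = u' ≫ v' ∧ u ≤ u' ∧ v ≤ v')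
    {n : ℕ} {a b c c' : NLevel A n} (u : a ⟶ c) (v : c ⟶ b) (u' : a ⟶ c') (v' : c' ⟶ b)
    (h : ∀ i, ∃ w : c.obj ⟶ c'.obj, entryHom u i ≫ w = entryHom u' i ∧
      w ≫ entryHom v' i = entryHom v i) : ∃ w : c ⟶ c', u ≫ w = u' ∧ w ≫ v' = v := by
  choose w hw hw' using h
  have hmono : Monotone w := by
    intro i j hij
    have h1 : entryHom u i ≫ w i ≤ entryHom u' j := by
      rw [hw]
      exact entryHom_mono u' hij
    obtain ⟨p, q, h2, -, h3⟩ := hlift h1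
    rw [← hw] at h2
    rw [(H.factorization_unique h2).2]
    exact h3
  exact ⟨(⟨w, hmono⟩ : Fin (n + 1) →o (c.obj ⟶ c'.obj)), entryHom_ext hw, entryHom_ext hw'⟩

/-- If factorizations lift along the order of the morphisms, then the categories of chains inherit
unique factorization. -/
lemma nLevel (H : IsDirectLevi A deg)
    (hlift : ∀ {a b c : A} {u : a ⟶ c} {v : c ⟶ b} {γ : a ⟶ b}, u ≫ v ≤ γ →
      ∃ (u' : a ⟶ c) (v' : c ⟶ b), γ = u' ≫ v' ∧ u ≤ u' ∧ v ≤ v') (n : ℕ) :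
    IsDirectLevi (NLevel A n) fun a => deg a.obj where
  deg_lt {a b} f := by
    rcases H.deg_lt (entryHom f 0) with h | ⟨h, -⟩
    · exact Or.inl h
    · obtain ⟨a⟩ := a
      obtain ⟨b⟩ := b
      obtain rfl : a = b := h
      exact Or.inr ⟨rfl, entryHom_ext fun i => H.eq_id _⟩
  levi {a b c c'} u v u' v' h := by
    have hi : ∀ i, entryHom u i ≫ entryHom v i = entryHom u' i ≫ entryHom v' i := fun i =>
      congrArg (fun k : a ⟶ b => entryHom k i) h
    by_cases hc : c = c'
    · subst hc
      refine Or.inl ⟨𝟙 c, ?_, ?_⟩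
      · rw [Category.comp_id]
        exact entryHom_ext fun i => (H.factorization_unique (hi i)).1
      · rw [Category.id_comp]
        exact entryHom_ext fun i => (H.factorization_unique (hi i)).2.symm
    · have hdeg : ∀ {x y : NLevel A n}, x ≠ y → (x.obj ⟶ y.obj) → deg y.obj < deg x.obj :=
        fun hxy k => (H.deg_lt k).resolve_right fun h => hxy (NLevel.ext h.1)
      -- the degrees decide in which direction the two factorizations compare
      rcases lt_or_ge (deg c'.obj) (deg c.obj) with hlt | hle
      · refine Or.inl (exists_nLevel_comparison H hlift u v u' v' fun i => ?_)
        refine (H.levi _ _ _ _ (hi i)).resolve_right ?_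
        rintro ⟨w, -⟩
        exact lt_asymm hlt (hdeg (Ne.symm hc) w)
      · refine Or.inr (exists_nLevel_comparison H hlift u' v' u v fun i => ?_)
        refine (H.levi _ _ _ _ (hi i)).resolve_left ?_
        rintro ⟨w, -⟩
        exact absurd (hdeg hc w) (not_lt.2 hle)

end IsDirectLevi

namespace CWCell

variable {X : Type u} [TopologicalSpace X] {C : Set X} [Topology.CWComplex C] {φ : CWCell C → ℝ}

lemma IsDiscreteMorse.isMatching [T2Space X] (hC : IsRegularCW C) (hφ : IsDiscreteMorse φ) :
    IsMatching φ where
  up h h' := hφ.up _ _ _ h.1 h'.1 h.2.1 h'.2.1 h.2.2 h'.2.2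
  down h h' := hφ.down _ _ _ h.1 h'.1 h.2.1 h'.2.1 h.2.2 h'.2.2
  not_both h h' := not_regularPair_regularPair hC hφ h h'

end CWCell

namespace Flo

open CWCell

variable {X : Type u} [TopologicalSpace X] {C : Set X} [Topology.CWComplex C] {φ : CWCell C → ℝ}

/-- The discrete flow category, graded by the dimension of the critical cells, has unique
factorization into indecomposable morphisms. -/
lemma isDirectLevi (hM : IsMatching φ) : IsDirectLevi (Flo φ) fun a => a.cell.dim where
  deg_lt {a b} f := by
    rcases dim_lt_or_eq hM a.critical b.critical f with h | ⟨h, hf⟩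
    · exact Or.inl h
    · obtain ⟨a, ha⟩ := a
      obtain ⟨b, hb⟩ := b
      obtain rfl : a = b := h
      exact Or.inr ⟨rfl, hf⟩
  levi {a b c c'} u v u' v' h := exists_comparison hM c.critical c'.critical h

lemma isDirectLevi_nLevel (hM : IsMatching φ) (n : ℕ) :
    IsDirectLevi (NLevel (Flo φ) n) fun a => a.obj.cell.dim :=
  (isDirectLevi hM).nLevel (fun h => exists_lift hM h) n

end Flo

/-! ### The first spectral sequence of a double complex -/

namespace DoubleCx

variable {K : HomologicalComplex₂ AddCommGrpCat.{u} (ComplexShape.down ℕ) (ComplexShape.down ℕ)}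

lemma mem_F_of_le {p p' n n' : ℤ} {x : Tot K} (hx : x ∈ F K p n) (hp : p ≤ p') (hn : n = n') :
    x ∈ F K p' n' := fun ij hij => ⟨(hx ij hij).1.trans hp, (hx ij hij).2.trans hn⟩

lemma ι_mem_F {i j : ℕ} {p n : ℤ} (hp : (i : ℤ) ≤ p) (hn : (i : ℤ) + j = n)
    (x : entry K (i, j)) : ι K i j x ∈ F K p n := by
  intro ij hij
  by_cases h : (i, j) = ij
  · subst h
    exact ⟨hp, hn⟩
  · exact absurd (DirectSum.of_eq_of_ne _ _ _ (Ne.symm h)) hij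

lemma eq_zero_of_ι_mem_F {i j : ℕ} {p n : ℤ} (hp : p < i) {x : entry K (i, j)}
    (h : ι K i j x ∈ F K p n) : x = 0 := by
  by_contra hx
  have h1 := (h (i, j) (by rwa [DirectSum.of_eq_same])).1
  exact absurd hp (not_lt.2 h1)

lemma eq_zero_of_mem_F {p n : ℤ} (hp : p < 0) {x : Tot K} (hx : x ∈ F K p n) : x = 0 := by
  refine DFinsupp.ext fun ij => ?_
  by_contra h
  have := (hx ij h).1
  omega

lemma sub_ι_mem_F {p q : ℕ} {x : Tot K} (hx : x ∈ F K p (p + q)) :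
    x - ι K p q (x (p, q)) ∈ F K (p - 1) (p + q) := by
  intro ij h
  by_cases hij : ij = (p, q)
  · subst hij
    rw [DirectSum.sub_apply, DirectSum.of_eq_same, sub_self] at h
    exact absurd rfl h
  · rw [DirectSum.sub_apply, DirectSum.of_eq_of_ne _ _ _ hij, sub_zero] at h
    obtain ⟨h1, h2⟩ := hx ij h
    refine ⟨?_, h2⟩
    by_contra h3
    exact hij (Prod.ext (by omega) (by omega))

lemma dh_zero (q : ℕ) (x : entry K (0, q)) : dh K 0 q x = 0 := by
  have h : K.d 0 (0 - 1) = 0 := K.shape _ _ (by simp)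
  exact congrArg (fun f => (f.f q).hom x) h

lemma ι_dh_mem_F {p q : ℕ} (x : entry K (p, q)) :
    ι K (p - 1) q (dh K p q x) ∈ F K (p - 1) (p + q - 1) := by
  cases p with
  | zero =>
    rw [dh_zero, map_zero]
    exact zero_mem _
  | succ p => exact ι_mem_F (by push_cast; omega) (by push_cast; omega) _

lemma ι_dv_mem_F {p q : ℕ} (x : entry K (p, q)) :
    ι K p (q - 1) (dv K p q x) ∈ F K p (p + q - 1) := by
  cases q with
  | zero =>
    rw [dv_zero, map_zero]
    exact zero_mem _
  | succ q => exact ι_mem_F le_rfl (by push_cast; omega) _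

lemma D_ι_mem_F {p q : ℕ} (x : entry K (p, q)) : D K (ι K p q x) ∈ F K p (p + q - 1) := by
  rw [D_ι]
  exact add_mem (ι_dv_mem_F x) (zsmul_mem (mem_F_of_le (ι_dh_mem_F x) (by omega) rfl) _)

lemma D_mem_F {p n : ℤ} {x : Tot K} (hx : x ∈ F K p n) : D K x ∈ F K p (n - 1) := by
  classical
  rw [← DirectSum.sum_support_of x, map_sum]
  refine sum_mem fun ij hij => ?_
  obtain ⟨h1, rfl⟩ := hx ij (DFinsupp.mem_support_iff.1 hij)
  exact mem_F_of_le (D_ι_mem_F (x ij)) h1 rfl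

lemma dv_eq_zero {p q : ℕ} {x : Tot K} (hx : x ∈ F K p (p + q))
    (hD : D K x ∈ F K (p - 1) (p + q - 1)) : dv K p q (x (p, q)) = 0 := by
  have h1 := sub_mem hD (D_mem_F (sub_ι_mem_F hx))
  rw [← map_sub, sub_sub_cancel, D_ι] at h1
  have h2 := sub_mem h1 (zsmul_mem (ι_dh_mem_F (x (p, q))) ((-1 : ℤ) ^ q))
  rw [add_sub_cancel_right] at h2
  exact eq_zero_of_ι_mem_F (by omega) h2

lemma subsingleton_E {r p q : ℤ} (h : ∀ x ∈ Z K r p q, x ∈ B K r p q) :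
    Subsingleton (E K r p q) := by
  have h1 : (B K r p q).addSubgroupOf (Z K r p q) = ⊤ :=
    AddSubgroup.addSubgroupOf_eq_top.2 h
  rw [E, h1]
  exact QuotientAddGroup.subsingleton_quotient_top

lemma subsingleton_E_of_neg_left {r p q : ℤ} (hp : p < 0) : Subsingleton (E K r p q) :=
  subsingleton_E fun x hx => by
    rw [eq_zero_of_mem_F hp hx.1]
    exact zero_mem _

lemma subsingleton_E_of_neg_right {r p q : ℤ} (hq : q < 0) : Subsingleton (E K r p q) :=
  subsingleton_E fun x hx => by
    refine AddSubgroup.mem_sup_left ⟨fun ij hij => ?_, mem_F_of_le hx.2 (by omega) (by omega)⟩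
    obtain ⟨h1, h2⟩ := hx.1 ij hij
    omega

/-- An element of `Z^r_{p,q}` represents zero in `E^r_{p,q}` if, modulo `F_{p-1}`, it is the
boundary of an element of `F_{p+r-1}`. -/
lemma mem_B {r p q : ℤ} {x y : Tot K} (hx : x ∈ Z K r p q) (hy : y ∈ F K (p + r - 1) (p + q + 1))
    (hxy : x - D K y ∈ F K (p - 1) (p + q)) : x ∈ B K r p q := by
  have hD : D K y ∈ F K p (p + q) := by
    have h := sub_mem (show x ∈ F K p (p + q) from hx.1) (mem_F_of_le hxy (by omega) rfl)
    rwa [sub_sub_cancel] at h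
  refine AddSubgroup.mem_sup.2 ⟨x - D K y, ⟨mem_F_of_le hxy le_rfl (by omega), ?_⟩, D K y,
    ⟨y, ⟨mem_F_of_le hy le_rfl (by omega), mem_F_of_le hD (by omega) (by omega)⟩, rfl⟩,
    sub_add_cancel _ _⟩
  change D K (x - D K y) ∈ F K _ _
  rw [map_sub, D_D, sub_zero]
  exact mem_F_of_le hx.2 (by omega) (by omega)

/-- A position at which the columns are exact vanishes from the first page on. -/
lemma subsingleton_E_of_exact {r : ℤ} {p q : ℕ} (hr : 1 ≤ r)
    (h : ∀ x : entry K (p, q), dv K p q x = 0 → ∃ y : entry K (p, q + 1), dv K p (q + 1) y = x) :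
    Subsingleton (E K r p q) := by
  refine subsingleton_E fun x hx => ?_
  obtain ⟨y, hy⟩ := h _ (dv_eq_zero hx.1 (mem_F_of_le hx.2 (by omega) rfl))
  refine mem_B hx (ι_mem_F (by omega) (by push_cast; ring) y) ?_
  have h1 := sub_mem (sub_ι_mem_F hx.1) (mem_F_of_le
    (zsmul_mem (ι_dh_mem_F y) ((-1 : ℤ) ^ (q + 1))) le_rfl (by push_cast; ring))
  rw [D_ι]
  rw [← hy, sub_sub] at h1
  exact h1

/-- A position of the row `q = 0` of the second page vanishes if, modulo vertical boundaries, every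
horizontal cycle there is a horizontal boundary. -/
lemma subsingleton_E_two {p : ℕ}
    (h : ∀ (x : entry K (p + 1, 0)) (e : entry K (p, 1)), dh K (p + 1) 0 x = dv K p 1 e →
      ∃ (y : entry K (p + 1, 0)) (a : entry K (p + 2, 0)) (b : entry K (p + 1, 1)),
        dh K (p + 2) 0 a = y ∧ dv K (p + 1) 1 b = x - y) :
    Subsingleton (E K 2 (p + 1 : ℕ) 0) := by
  refine subsingleton_E fun x hx => ?_
  have hx1 : x ∈ F K (p + 1 : ℕ) ((p + 1 : ℕ) + (0 : ℕ)) := mem_F_of_le hx.1 le_rfl rfl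
  have hx2 := sub_ι_mem_F hx1
  have hx3 : x - ι K (p + 1) 0 (x (p + 1, 0)) ∈ F K p (p + (1 : ℕ)) :=
    mem_F_of_le hx2 (by push_cast; omega) (by push_cast; ring)
  have hx4 := D_mem_F (sub_ι_mem_F hx3)
  generalize (x - ι K (p + 1) 0 (x (p + 1, 0))) (p, 1) = e at hx4
  generalize x (p + 1, 0) = c at hx2 hx4
  have hD : ∀ (i : ℕ) (k : entry K (i + 1, 0)) (l : entry K (i, 0)), dh K (i + 1) 0 k = l →
      D K (ι K (i + 1) 0 k) = ι K i 0 l := by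
    rintro i k _ rfl
    rw [D_ι, dv_zero, map_zero, zero_add, pow_zero, one_smul]
    rfl
  have hD' : ∀ (i : ℕ) (k : entry K (i, 1)) (l : entry K (i, 0)), dv K i 1 k = l →
      D K (ι K i 1 k) = ι K i 0 l - ι K (i - 1) 1 (dh K i 1 k) := by
    rintro i k _ rfl
    rw [D_ι, pow_one, neg_one_smul, ← sub_eq_add_neg]
  have hce : dh K (p + 1) 0 c = dv K p 1 (-e) := by
    have h1 := sub_mem (mem_F_of_le hx.2 (by push_cast; omega) (by push_cast; ring) :
      D K x ∈ F K (p - 1) (p + (1 : ℕ) - 1)) hx4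
    have h2 := add_mem h1 (ι_dh_mem_F e)
    rw [← map_sub, sub_sub, sub_sub_cancel, map_add, hD p c _ rfl, hD' p e _ rfl, add_assoc,
      sub_add_cancel, ← map_add] at h2
    rw [map_neg]
    exact eq_neg_of_add_eq_zero_left (eq_zero_of_ι_mem_F (by omega) h2)
  obtain ⟨y, a, b, ha, hb⟩ := h c (-e) hce
  refine mem_B hx (y := ι K (p + 2) 0 a + ι K (p + 1) 1 b)
    (add_mem (ι_mem_F (by push_cast; omega) (by push_cast; ring) a)
      (ι_mem_F (by push_cast; omega) (by push_cast; ring) b)) ?_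
  have h1 := add_mem hx2 (mem_F_of_le (ι_dh_mem_F b) le_rfl (by push_cast; ring))
  have h2 : x - D K (ι K (p + 2) 0 a + ι K (p + 1) 1 b) =
      x - ι K (p + 1) 0 c + ι K (p + 1 - 1) 1 (dh K (p + 1) 1 b) := by
    rw [map_add, hD (p + 1) a y ha, hD' (p + 1) b _ hb, map_sub]
    abel
  rw [h2]
  exact h1

end DoubleCx

/-! ### The double complex of a bisimplicial set -/

section bisimplicial

open Opposite Simplicial

variable (S : SimplexCategoryᵒᵖ ⥤ SSet.{u})

lemma hom_sum_zsmul_apply {ι : Type*} [Fintype ι] {M N : AddCommGrpCat.{u}} (n : ι → ℤ)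
    (f : ι → (M ⟶ N)) (x : M) : (∑ i, n i • f i).hom x = ∑ i, n i • (f i).hom x := by
  have h := map_sum ((AddMonoidHom.eval x).comp
    (AddCommGrpCat.homAddEquiv (M := M) (N := N)).toAddMonoidHom) (fun i => n i • f i) Finset.univ
  exact h

/-- The vertical differential is the alternating sum of the inner face maps. -/
lemma dv_bisimplicialDoubleComplex (p q : ℕ)
    (x : FreeAbelianGroup ((S.obj (op ⦋p⦌)).obj (op ⦋q + 1⦌))) :
    DoubleCx.dv (bisimplicialDoubleComplex S) p (q + 1) x =
      ∑ i : Fin (q + 2), (-1 : ℤ) ^ (i : ℕ) •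
        FreeAbelianGroup.map ((S.obj (op ⦋p⦌)).δ i) x := by
  have h := AlgebraicTopology.alternatingFaceMapComplex_obj_d
    (((SimplicialObject.whiskering (Type u) AddCommGrpCat.{u}).obj AddCommGrpCat.free).obj
      (S.obj (op ⦋p⦌))) q
  exact (congrArg (fun f => f.hom x) h).trans (hom_sum_zsmul_apply
    (fun i : Fin (q + 2) => (-1 : ℤ) ^ (i : ℕ)) (fun i => SimplicialObject.δ
      (((SimplicialObject.whiskering (Type u) AddCommGrpCat.{u}).obj AddCommGrpCat.free).obj
        (S.obj (op ⦋p⦌))) i) x)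

/-- The horizontal differential is the alternating sum of the outer face maps. -/
lemma dh_bisimplicialDoubleComplex (p q : ℕ)
    (x : FreeAbelianGroup ((S.obj (op ⦋p + 1⦌)).obj (op ⦋q⦌))) :
    DoubleCx.dh (bisimplicialDoubleComplex S) (p + 1) q x =
      ∑ i : Fin (p + 2), (-1 : ℤ) ^ (i : ℕ) •
        FreeAbelianGroup.map ((SimplicialObject.δ S i).app (op ⦋q⦌)) x := by
  have h := AlgebraicTopology.alternatingFaceMapComplex_obj_d
    (S ⋙ (SimplicialObject.whiskering (Type u) AddCommGrpCat.{u}).obj AddCommGrpCat.free ⋙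
      AlgebraicTopology.alternatingFaceMapComplex AddCommGrpCat.{u}) p
  have h' := map_sum (HomologicalComplex.Hom.fAddMonoidHom q)
    (fun i : Fin (p + 2) => (-1 : ℤ) ^ (i : ℕ) • SimplicialObject.δ
      (S ⋙ (SimplicialObject.whiskering (Type u) AddCommGrpCat.{u}).obj AddCommGrpCat.free ⋙
        AlgebraicTopology.alternatingFaceMapComplex AddCommGrpCat.{u}) i) Finset.univ
  exact (congrArg (fun f => (f.f q).hom x) h).trans
    ((congrArg (fun f => f.hom x) h').trans (hom_sum_zsmul_apply
      (fun i : Fin (p + 2) => (-1 : ℤ) ^ (i : ℕ)) (fun i => HomologicalComplex.Hom.f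
        (SimplicialObject.δ (S ⋙ (SimplicialObject.whiskering (Type u) AddCommGrpCat.{u}).obj
          AddCommGrpCat.free ⋙ AlgebraicTopology.alternatingFaceMapComplex AddCommGrpCat.{u}) i)
        q) x))

end bisimplicial

/-! ### The double complex of the double nerve -/

section doubleNerve

open Opposite Simplicial

lemma dv_map (S : SimplexCategoryᵒᵖ ⥤ SSet.{u}) {p p' q : ℕ}
    (θ : op ⦋p⦌ ⟶ op ⦋p'⦌) (x : FreeAbelianGroup ((S.obj (op ⦋p⦌)).obj (op ⦋q + 1⦌))) :
    DoubleCx.dv (bisimplicialDoubleComplex S) p' (q + 1)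
        (FreeAbelianGroup.map ((S.map θ).app (op ⦋q + 1⦌)) x) =
      FreeAbelianGroup.map ((S.map θ).app (op ⦋q⦌))
        (DoubleCx.dv (bisimplicialDoubleComplex S) p (q + 1) x) := by
  rw [dv_bisimplicialDoubleComplex, dv_bisimplicialDoubleComplex]
  refine Eq.trans ?_ (map_sum _ _ _).symm
  refine Finset.sum_congr rfl fun i _ => ?_
  refine Eq.trans (congrArg _ ?_) (map_zsmul _ _ _).symm
  refine (FreeAbelianGroup.map_comp_apply _).symm.trans
    (Eq.trans ?_ (FreeAbelianGroup.map_comp_apply _))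
  refine congrArg (fun k => FreeAbelianGroup.map k x) (funext fun σ => ?_)
  exact congrArg (fun k => k σ) ((S.map θ).naturality (SimplexCategory.δ i).op).symm

variable {A : Type u} [PCategory.{v} A]

lemma dv_doubleNerve (p q : ℕ) (x : FreeAbelianGroup (ComposableArrows (NLevel A p) (q + 1))) :
    DoubleCx.dv (bisimplicialDoubleComplex (doubleNerve A)) p (q + 1) x =
      nerveBoundary (NLevel A p) q x := by
  rw [nerveBoundary, AddMonoidHom.finsetSum_apply]
  exact dv_bisimplicialDoubleComplex (doubleNerve A) p q x

/-- The identification of the objects of a level of the simplicial category of `A` with those of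
`A`, extended to `0`-chains. -/
def objMap (A : Type u) [PCategory.{v} A] (p : ℕ) :
    FreeAbelianGroup (ComposableArrows (NLevel A p) 0) →+ FreeAbelianGroup A :=
  FreeAbelianGroup.map fun σ => (σ.obj 0).obj

lemma objMap_map {p p' : ℕ} (θ : op ⦋p⦌ ⟶ op ⦋p'⦌)
    (x : FreeAbelianGroup (ComposableArrows (NLevel A p) 0)) :
    objMap A p' (FreeAbelianGroup.map (((doubleNerve A).map θ).app (op ⦋0⦌)) x) =
      objMap A p x :=
  (FreeAbelianGroup.map_comp_apply _).symm

lemma objMap_bijective (p : ℕ) : Function.Bijective (objMap A p) := by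
  refine Function.bijective_iff_has_inverse.2
    ⟨FreeAbelianGroup.map fun a => ComposableArrows.mk₀ ⟨a⟩, fun x => ?_, fun x => ?_⟩
  · rw [objMap, ← FreeAbelianGroup.map_comp_apply]
    refine (congrArg (fun f => FreeAbelianGroup.map f x) ?_).trans (FreeAbelianGroup.map_id_apply x)
    funext σ
    exact ComposableArrows.ext₀ rfl
  · rw [objMap, ← FreeAbelianGroup.map_comp_apply]
    exact FreeAbelianGroup.map_id_apply x

/-- On `0`-simplices all the horizontal faces are the identity on objects. -/
lemma objMap_dh (p : ℕ) (x : FreeAbelianGroup (ComposableArrows (NLevel A (p + 1)) 0)) :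
    objMap A p (DoubleCx.dh (bisimplicialDoubleComplex (doubleNerve A)) (p + 1) 0 x) =
      if Even p then 0 else objMap A (p + 1) x := by
  refine (congrArg _ (dh_bisimplicialDoubleComplex (doubleNerve A) p 0 x)).trans ?_
  refine (map_sum _ _ _).trans ?_
  have h : ∀ i : Fin (p + 2), objMap A p ((-1 : ℤ) ^ (i : ℕ) •
      FreeAbelianGroup.map ((SimplicialObject.δ (doubleNerve A) i).app (op ⦋0⦌)) x) =
        (-1 : ℤ) ^ (i : ℕ) • objMap A (p + 1) x := fun i =>
    (map_zsmul _ _ _).trans (congrArg _ (objMap_map (SimplexCategory.δ i).op x))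
  refine (Finset.sum_congr rfl fun i _ => h i).trans ?_
  rw [← Finset.sum_smul, Fin.sum_neg_one_pow]
  by_cases hp : Even p
  · simp [hp, Nat.even_add]
  · simp [hp, Nat.even_add]

/-- The row `q = 0` of the double complex is the chain complex of the constant simplicial set of
objects, whose differentials are alternately zero and bijective. -/
lemma subsingleton_E_two_doubleNerve (p : ℕ) :
    Subsingleton (DoubleCx.E (bisimplicialDoubleComplex (doubleNerve A)) 2 (p + 1 : ℕ) 0) := by
  refine DoubleCx.subsingleton_E_two fun x e h => ?_
  by_cases hp : Even p
  -- the differential into this position is surjective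
  · obtain ⟨a, ha⟩ := (objMap_bijective (p + 2)).2 (objMap A (p + 1) x)
    refine ⟨x, a, 0, (objMap_bijective (p + 1)).1 ?_, ?_⟩
    · refine (objMap_dh (p + 1) a).trans ?_
      rw [if_neg (by simpa [Nat.even_add_one] using hp), ha]
    · rw [map_zero, sub_self]
  -- the differential is injective here, and a degeneracy lifts the vertical boundary
  · refine ⟨0, 0, FreeAbelianGroup.map
      (((doubleNerve A).map (SimplexCategory.σ 0).op).app (op ⦋1⦌)) e, map_zero _, ?_⟩
    rw [sub_zero]
    refine (objMap_bijective (p + 1)).1 ?_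
    refine (congrArg _ (dv_map (doubleNerve A) (SimplexCategory.σ 0).op e)).trans ?_
    refine (objMap_map (SimplexCategory.σ 0).op _).trans ?_
    have h1 := objMap_dh p x
    rw [if_neg hp] at h1
    rw [← h1]
    exact congrArg (objMap A p) h.symm

/-- The columns are the chain complexes of the nerves of the levels, which are exact in degrees at
least two. -/
lemma subsingleton_E_doubleNerve
    (h : ∀ p : ℕ, ∃ deg : NLevel A p → ℕ, IsDirectLevi (NLevel A p) deg) {r p q : ℤ} (hr : 1 ≤ r)
    (hq : 2 ≤ q) : Subsingleton (DoubleCx.E (bisimplicialDoubleComplex (doubleNerve A)) r p q) := by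
  rcases lt_or_ge p 0 with hp | hp
  · exact DoubleCx.subsingleton_E_of_neg_left hp
  lift p to ℕ using hp
  obtain ⟨n, rfl⟩ : ∃ n : ℕ, q = (n + 2 : ℕ) := ⟨(q - 2).toNat, by omega⟩
  obtain ⟨deg, hdeg⟩ := h p
  refine DoubleCx.subsingleton_E_of_exact hr fun x hx => ?_
  obtain ⟨y, hy⟩ := hdeg.exists_nerveBoundary_eq x ((dv_doubleNerve p (n + 1) x).symm.trans hx)
  exact ⟨y, (dv_doubleNerve p (n + 2) y).trans hy⟩

lemma d_doubleNerve_eq_zero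
    (h : ∀ p : ℕ, ∃ deg : NLevel A p → ℕ, IsDirectLevi (NLevel A p) deg) {r p q : ℤ}
    (hr : 2 ≤ r) : DoubleCx.d (bisimplicialDoubleComplex (doubleNerve A)) r p q = 0 := by
  have hsource : Subsingleton (DoubleCx.E (bisimplicialDoubleComplex (doubleNerve A)) r p q) →
      DoubleCx.d (bisimplicialDoubleComplex (doubleNerve A)) r p q = 0 := fun _ =>
    AddMonoidHom.ext fun x => by rw [Subsingleton.elim x 0, map_zero, map_zero]
  have htarget : Subsingleton (DoubleCx.E (bisimplicialDoubleComplex (doubleNerve A)) r (p - r)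
      (q + r - 1)) → DoubleCx.d (bisimplicialDoubleComplex (doubleNerve A)) r p q = 0 := fun _ =>
    AddMonoidHom.ext fun x => Subsingleton.elim _ _
  rcases lt_or_ge q 0 with hq | hq
  · exact hsource (DoubleCx.subsingleton_E_of_neg_right hq)
  rcases le_or_gt 2 (q + r - 1) with hqr | hqr
  · exact htarget (subsingleton_E_doubleNerve h (by omega) hqr)
  -- the remaining differentials leave the row `q = 0` of the second page
  obtain rfl : r = 2 := by omega
  obtain rfl : q = 0 := by omega
  rcases lt_or_ge p 1 with hp | hp
  · exact htarget (DoubleCx.subsingleton_E_of_neg_left (by omega))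
  · obtain ⟨n, rfl⟩ : ∃ n : ℕ, p = (n + 1 : ℕ) := ⟨(p - 1).toNat, by omega⟩
    exact hsource (subsingleton_E_two_doubleNerve n)

end doubleNerve

theorem theoremB {X : Type u} [TopologicalSpace X] [T2Space X] (C : Set X) [Topology.CWComplex C]
    (hC : IsRegularCW C) (φ : CWCell C → ℝ) (hφ : CWCell.IsDiscreteMorse φ) :
    (∀ r p q : ℤ, 2 ≤ r →
      DoubleCx.d (bisimplicialDoubleComplex (doubleNerve (Flo φ))) r p q = 0) ∧
    (∀ p q : ℤ, 2 ≤ q →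
      Subsingleton (DoubleCx.E (bisimplicialDoubleComplex (doubleNerve (Flo φ))) 1 p q)) ∧
    (∀ p : ℤ, 1 ≤ p →
      Subsingleton (DoubleCx.E (bisimplicialDoubleComplex (doubleNerve (Flo φ))) 2 p 0)) := by
  have h : ∀ p : ℕ, ∃ deg : NLevel (Flo φ) p → ℕ, IsDirectLevi (NLevel (Flo φ) p) deg :=
    fun p => ⟨_, Flo.isDirectLevi_nLevel (hφ.isMatching hC) p⟩
  refine ⟨fun r p q hr => d_doubleNerve_eq_zero h hr,
    fun p q hq => subsingleton_E_doubleNerve h le_rfl hq, fun p hp => ?_⟩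
  obtain ⟨n, rfl⟩ : ∃ n : ℕ, p = (n + 1 : ℕ) := ⟨(p - 1).toNat, by omega⟩
  exact subsingleton_E_two_doubleNerve n
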